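/- **Setting.** Let $\mathbb T=\mathbb R/\mathbb Z$. Let $A:\mathbb T^2\to\mathbb T^2$ be a $C^2$ Anosov diffeomorphism with invariant splitting $T_p\mathbb T^2=E_A^s(p)\oplus E_A^u(p)$ into lines and a constant $\lambda_A<1$ such that $\|DA_pw\|\le\lambda_A\|w\|$ for $w\in E^s_A(p)$ and $\|D(A^{-1})_pv\|\le\lambda_A\|v\|$ for $v\in E_A^u(p)$. Let $g:\mathbb T\to\mathbb T$ be an orientation preserving $C^2$ diffeomorphism of *north-south type*: it has two distinct fixed points $z_r,z_a$ with $\lambda_g^{max}:=\max g'=g'(z_r)$, $\lambda_g^{min}:=\min g'=g'(z_a)$, and $g^nz\to z_a$, $g^{-n}z\to z_r$ as $n\to\infty$ for all $z\ne z_r,z_a$. Let $r:\mathbb T\to\mathbb T$ be an orientation preserving $C^2$ diffeomorphism, and let $F(x,y,z)=(A(x,y),\,g(z+r(x)))$ on $\mathbb T^2\times\mathbb T$. Assume: (A1) $\lambda_A<\lambda_g^{min}<1<\lambda_g^{max}<\lambda_A^{-1}$; (A2) $c\le r'\le C$ for constants $c,C>0$; (A3) $E^u_A(p)$ and $E^s_A(p)$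 are nowhere parallel to the $y$-axis; let $\partial^u_A(p)\in E^u_A(p)$ and $\partial_A^s(p)\in E^s_A(p)$ be the unit vectors with positive, respectively negative, $x$-component, and let $\beta>0$ satisfy $\partial_A^u(p)\cdot\partial_x\ge\beta$ for all $p$; moreover $DA_p\partial_A^u(p)=\alpha^u(p)\,\partial_A^u(Ap)$ and $DA_p\partial_A^s(p)=\alpha^s(p)\,\partial_A^s(Ap)$ with $\alpha^u,\alpha^s>0$. Put $\alpha^u_{min}=\min\alpha^u$. Let $E^c=\langle\partial_z\rangle$ and let $E^u$ be the strong unstable line field of $F$, $E^u(p)=\{v:\ \sup_{n\ge0}\lambda_A^{-n}\|DF^{-n}_pv\|<\infty\}$; $W^u$-curves are the regular $C^1$ curves tangent to $E^u$. A bounded piece $V$ of a $W^u$-curve is a *fundamental domain* if its projection $\pi_z(V)$ to the last factor is $\mathbb T$ and no proper subset of $V$ has this property. For a bounded piece $W$ of a $W^u$-curve with arclength measure $m_W$, let $d\mu_W=\rho_W\,dm_W$, where $\rho_W>0$, $\int_W\rho_W\,dm_W=1$ and $$\frac{\rho_W(p)}{\rho_W(p')}=\lim_{n\to\infty}\prod_{i=1}^n\frac{\|DF_{F^{-i}p'}|_{E^u}\|}{\|DF_{F^{-i}p}|_{E^u}\|}\qquad(p,p'\in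 W).$$ For a bounded piece $W$ of an unstable leaf of $A$ let $\rho_W$ be defined in the same way with $A$, $E_A^u$ in place of $F$, $E^u$. $F$ satisfies the *contracting center (CC) condition* if there is $c_1>0$ such that for every fundamental domain $V$ the density $\rho_{F^{-1}V}$ exists and $$\int_{F^{-1}V}\log\|DF_p|_{E^c}\|\,d\mu_{F^{-1}V}(p)\le-c_1 .$$ Call $K_A$ a *distortion constant* if $\rho_W(p)/\rho_W(p')\le K_A$ for all $p,p'\in W$, for every segment $W=A^{-1}(\pi_{xy}V)$ of an unstable leaf of $A$, $V$ a fundamental domain and $\pi_{xy}$ the projection to $\mathbb T^2$. Let $I^+=\{g'\ge1\}$ and $I^-=\{g'<1\}$. **Proposition 4.5.** Assume (A1)–(A3) and let $K_A$ be a distortion constant. If $$\left[\frac{CK_A^2}{c\beta}\left(1+\frac{2\lambda_g^{max}}{\alpha^u_{min}-\lambda_g^{max}}\right)\right]\int_{I^+}\log g'(s)\,ds+\int_{I^-}\log g'(s)\,ds<0,\qquad(*)$$ then $F$ satisfies the CC-condition. **Example.** For every $g$ of north-south type there is $N_0$ such that for all $N\ge N_0$ and every $r$ with $r'\equiv1$,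 the map $F$ built from $g$, $r$ and the linear map $A=\begin{pmatrix}N&N-1\\1&1\end{pmatrix}$ satisfies (A1)–(A3) and $(*)$ for suitable $\lambda_A$, $\beta$ and $K_A=c=C=1$; in particular it satisfies the CC-condition. -/

import Mathlib

open Set Filter Topology MeasureTheory

noncomputable section

namespace SkewCoupling

/-! ### Tori and their diffeomorphisms -/

/-- The universal cover `ℝⁿ` of the `n`-torus with the Euclidean norm. It also serves as the
tangent space of the torus at each of its points. -/
abbrev Cover (n : ℕ) : Type := EuclideanSpace ℝ (Fin n)

/-- The `n`-torus `(ℝ/ℤ)ⁿ`. -/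
abbrev Torus (n : ℕ) : Type := Fin n → UnitAddCircle

/-- The covering map `ℝⁿ → (ℝ/ℤ)ⁿ`. -/
def proj {n : ℕ} (x : Cover n) : Torus n := fun i => (x i : UnitAddCircle)

/-- A `C²` diffeomorphism of the `n`-torus, together with a lift to the universal cover (every
diffeomorphism has one, unique up to an integer translation). The differential of the
diffeomorphism at `proj x` is `fderiv ℝ lift x`. -/
structure TorusDiffeo (n : ℕ) where
  toEquiv : Torus n ≃ Torus n
  lift : Cover n ≃ Cover n
  proj_lift : ∀ x, proj (lift x) = toEquiv (proj x)
  contDiff_lift : ContDiff ℝ 2 lift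
  contDiff_lift_symm : ContDiff ℝ 2 lift.symm

/-- An orientation preserving `C²` diffeomorphism of the circle `ℝ/ℤ`, together with a lift
to `ℝ`. -/
structure CircleDiffeo where
  toEquiv : UnitAddCircle ≃ UnitAddCircle
  lift : ℝ ≃ ℝ
  coe_lift : ∀ x : ℝ, ((lift x : ℝ) : UnitAddCircle) = toEquiv (x : UnitAddCircle)
  contDiff_lift : ContDiff ℝ 2 lift
  contDiff_lift_symm : ContDiff ℝ 2 lift.symm
  deriv_lift_pos : ∀ x : ℝ, 0 < deriv lift x

namespace CircleDiffeo

theorem deriv_lift_periodic (g : CircleDiffeo) : Function.Periodic (deriv g.lift) 1 := by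
  have hint : ∀ x : ℝ, ∃ m : ℤ, (m : ℝ) = g.lift (x + 1) - g.lift x := by
    intro x
    have h : ((g.lift (x + 1) - g.lift x : ℝ) : UnitAddCircle) = 0 := by
      rw [AddCircle.coe_sub, g.coe_lift, g.coe_lift, AddCircle.coe_add, AddCircle.coe_period,
        add_zero, sub_self]
    obtain ⟨m, hm⟩ := (AddCircle.coe_eq_zero_iff (1 : ℝ)).1 h
    exact ⟨m, by simpa using hm⟩
  choose m hm using hint
  have hc : Continuous g.lift := g.contDiff_lift.continuous
  have hcm : Continuous m := by
    have h1 : Continuous fun x => ((m x : ℤ) : ℝ) := by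
      simp only [hm]
      fun_prop
    exact Int.isClosedEmbedding_coe_real.isEmbedding.continuous_iff.2 h1
  have hconst : ∀ x, m x = m 0 := fun x =>
    PreconnectedSpace.constant inferInstance hcm
  intro x
  have h2 : (fun y => g.lift (y + 1)) = fun y => g.lift y + (m 0 : ℝ) := by
    funext y
    have := hm y
    rw [hconst y] at this
    linarith
  rw [← deriv_comp_add_const (f := g.lift) 1 x, h2]
  simp

/-- The derivative `g' : ℝ/ℤ → ℝ` of a circle diffeomorphism. -/
def deriv (g : CircleDiffeo) : UnitAddCircle → ℝ := g.deriv_lift_periodic.lift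

theorem deriv_coe (g : CircleDiffeo) (x : ℝ) :
    g.deriv (x : UnitAddCircle) = _root_.deriv g.lift x :=
  g.deriv_lift_periodic.lift_coe x

end CircleDiffeo

/-- The north-south condition on the fiber map: `zr` and `za` are distinct fixed points at which
`g'` takes its maximum and its minimum, and every other orbit tends to `za` in the future and to
`zr` in the past. -/
structure IsNorthSouth (g : CircleDiffeo) (zr za : UnitAddCircle) : Prop where
  ne : zr ≠ za
  fixed_r : g.toEquiv zr = zr
  fixed_a : g.toEquiv za = za
  deriv_le : ∀ z, g.deriv z ≤ g.deriv zr
  le_deriv : ∀ z, g.deriv za ≤ g.deriv z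
  tendsto_a : ∀ z, z ≠ zr → z ≠ za → Tendsto (fun n : ℕ => g.toEquiv^[n] z) atTop (𝓝 za)
  tendsto_r : ∀ z, z ≠ zr → z ≠ za → Tendsto (fun n : ℕ => g.toEquiv.symm^[n] z) atTop (𝓝 zr)

/-- `A` is an Anosov diffeomorphism of the 2-torus with invariant splitting `Es ⊕ Eu` into lines,
with expansion and contraction in one step, at rate `lam`. -/
structure IsAnosov (A : TorusDiffeo 2) (lam : ℝ)
    (Es Eu : Torus 2 → Submodule ℝ (Cover 2)) : Prop where
  lam_lt_one : lam < 1
  finrank_stable : ∀ p, Module.finrank ℝ (Es p) = 1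
  finrank_unstable : ∀ p, Module.finrank ℝ (Eu p) = 1
  isCompl : ∀ p, IsCompl (Es p) (Eu p)
  map_stable : ∀ x : Cover 2,
    (Es (proj x)).map (fderiv ℝ A.lift x).toLinearMap = Es (A.toEquiv (proj x))
  map_unstable : ∀ x : Cover 2,
    (Eu (proj x)).map (fderiv ℝ A.lift x).toLinearMap = Eu (A.toEquiv (proj x))
  contract_stable : ∀ x : Cover 2, ∀ w ∈ Es (proj x), ‖fderiv ℝ A.lift x w‖ ≤ lam * ‖w‖
  contract_unstable : ∀ x : Cover 2, ∀ v ∈ Eu (proj x),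
    ‖fderiv ℝ A.lift.symm x v‖ ≤ lam * ‖v‖

/-! ### The skew product -/

/-- The horizontal projection `π_xy` on the universal cover. -/
def horizontal (p : Cover 3) : Cover 2 := !₂[p 0, p 1]

/-- The vertical projection `π_z` to the circle. -/
def vertical (p : Cover 3) : UnitAddCircle := proj p 2

/-- The skew product `F(x, y, z) = (A(x, y), g(z + r(x)))`, a diffeomorphism of the 3-torus. -/
def skewProduct (A : TorusDiffeo 2) (g r : CircleDiffeo) : TorusDiffeo 3 where
  toEquiv :=
    { toFun := fun p => ![A.toEquiv ![p 0, p 1] 0, A.toEquiv ![p 0, p 1] 1,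
        g.toEquiv (p 2 + r.toEquiv (p 0))]
      invFun := fun q => ![A.toEquiv.symm ![q 0, q 1] 0, A.toEquiv.symm ![q 0, q 1] 1,
        g.toEquiv.symm (q 2) - r.toEquiv (A.toEquiv.symm ![q 0, q 1] 0)]
      left_inv := by
        intro p
        have h : ![A.toEquiv ![p 0, p 1] 0, A.toEquiv ![p 0, p 1] 1] = A.toEquiv ![p 0, p 1] := by
          ext i; fin_cases i <;> rfl
        ext i; fin_cases i <;> simp [h]
      right_inv := by
        intro q
        have h : ![A.toEquiv.symm ![q 0, q 1] 0, A.toEquiv.symm ![q 0, q 1] 1]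
            = A.toEquiv.symm ![q 0, q 1] := by
          ext i; fin_cases i <;> rfl
        ext i; fin_cases i <;> simp [h] }
  lift :=
    { toFun := fun p => !₂[A.lift !₂[p 0, p 1] 0, A.lift !₂[p 0, p 1] 1,
        g.lift (p 2 + r.lift (p 0))]
      invFun := fun q => !₂[A.lift.symm !₂[q 0, q 1] 0, A.lift.symm !₂[q 0, q 1] 1,
        g.lift.symm (q 2) - r.lift (A.lift.symm !₂[q 0, q 1] 0)]
      left_inv := by
        intro p
        have h : !₂[A.lift !₂[p 0, p 1] 0, A.lift !₂[p 0, p 1] 1] = A.lift !₂[p 0, p 1] := by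
          ext i; fin_cases i <;> rfl
        ext i; fin_cases i <;> simp [h]
      right_inv := by
        intro q
        have h : !₂[A.lift.symm !₂[q 0, q 1] 0, A.lift.symm !₂[q 0, q 1] 1]
            = A.lift.symm !₂[q 0, q 1] := by
          ext i; fin_cases i <;> rfl
        ext i; fin_cases i <;> simp [h] }
  proj_lift := by
    intro x
    have h : (![(x 0 : UnitAddCircle), (x 1 : UnitAddCircle)] : Torus 2) = proj !₂[x 0, x 1] := by
      ext i; fin_cases i <;> rfl
    ext i
    fin_cases i
    · change ((A.lift !₂[x 0, x 1] 0 : ℝ) : UnitAddCircle)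
        = A.toEquiv ![(x 0 : UnitAddCircle), (x 1 : UnitAddCircle)] 0
      rw [h, ← A.proj_lift]; rfl
    · change ((A.lift !₂[x 0, x 1] 1 : ℝ) : UnitAddCircle)
        = A.toEquiv ![(x 0 : UnitAddCircle), (x 1 : UnitAddCircle)] 1
      rw [h, ← A.proj_lift]; rfl
    · change ((g.lift (x 2 + r.lift (x 0)) : ℝ) : UnitAddCircle)
        = g.toEquiv ((x 2 : UnitAddCircle) + r.toEquiv (x 0 : UnitAddCircle))
      rw [g.coe_lift, AddCircle.coe_add, r.coe_lift]
  contDiff_lift := by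
    have hA := A.contDiff_lift
    have hg := g.contDiff_lift
    have hr := r.contDiff_lift
    have h2 : ContDiff ℝ 2 fun p : Cover 3 => (!₂[p 0, p 1] : Cover 2) := by
      rw [contDiff_euclidean]; intro i; fin_cases i <;> simp <;> fun_prop
    have h3 := contDiff_euclidean.1 (hA.comp h2)
    rw [contDiff_euclidean]
    intro i
    fin_cases i
    · exact h3 0
    · exact h3 1
    · exact hg.comp (ContDiff.add (by fun_prop) (hr.comp (by fun_prop)))
  contDiff_lift_symm := by
    have hA := A.contDiff_lift_symm
    have hg := g.contDiff_lift_symm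
    have hr := r.contDiff_lift
    have h2 : ContDiff ℝ 2 fun p : Cover 3 => (!₂[p 0, p 1] : Cover 2) := by
      rw [contDiff_euclidean]; intro i; fin_cases i <;> simp <;> fun_prop
    have h3 := contDiff_euclidean.1 (hA.comp h2)
    rw [contDiff_euclidean]
    intro i
    fin_cases i
    · exact h3 0
    · exact h3 1
    · exact ContDiff.sub (hg.comp (by fun_prop)) (hr.comp (h3 0))

/-! ### Unstable curves and their reference measures -/

/-- The vectors at `x` that `Df⁻ⁿ` contracts at the rate `lamⁿ`. For the skew product under the
domination condition `λ_g^max < lam⁻¹` this is the strong unstable line `E^u`. -/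
def unstableSpace {n : ℕ} (f : TorusDiffeo n) (lam : ℝ) (x : Cover n) :
    Submodule ℝ (Cover n) where
  carrier := {v | ∃ K : ℝ, ∀ k : ℕ, ‖fderiv ℝ (f.lift.symm^[k]) x v‖ ≤ K * lam ^ k}
  zero_mem' := ⟨0, fun k => by simp⟩
  add_mem' := by
    rintro v w ⟨K, hK⟩ ⟨L, hL⟩
    refine ⟨K + L, fun k => ?_⟩
    rw [map_add, add_mul]
    exact (norm_add_le _ _).trans (add_le_add (hK k) (hL k))
  smul_mem' := by
    rintro a v ⟨K, hK⟩
    refine ⟨|a| * K, fun k => ?_⟩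
    rw [map_smul, norm_smul, Real.norm_eq_abs, mul_assoc]
    exact mul_le_mul_of_nonneg_left (hK k) (abs_nonneg a)

/-- A regular `C¹` curve (in the universal cover) that is everywhere tangent to the field `E`.
For the strong unstable field these are the parametrized pieces of unstable leaves. -/
structure IsTangentCurve {n : ℕ} (E : Cover n → Submodule ℝ (Cover n)) (γ : ℝ → Cover n) :
    Prop where
  contDiff : ContDiff ℝ 1 γ
  deriv_ne_zero : ∀ t, deriv γ t ≠ 0
  tangent : ∀ t, deriv γ t ∈ E (γ t)

/-- The norm `‖Df_x|_E‖` of the differential on the line `E x`. -/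
def dilation {n : ℕ} (f : TorusDiffeo n) (E : Cover n → Submodule ℝ (Cover n)) (x : Cover n) : ℝ :=
  ‖(fderiv ℝ f.lift x).comp (E x).subtypeL‖

/-- The integral of `h` over the curve `γ(J)` with respect to arclength. -/
def arcIntegral {n : ℕ} (γ : ℝ → Cover n) (J : Set ℝ) (h : Cover n → ℝ) : ℝ :=
  ∫ t in J, h (γ t) * ‖deriv γ t‖

/-- `ρ` is the reference density `ρ_W` on the unstable segment `W = γ(J)` of `f`: it is positive,
`ρ(p)/ρ(p') = lim ∏_{i=1}^k ‖Df_{f⁻ⁱp'}|_E‖ / ‖Df_{f⁻ⁱp}|_E‖` for all `p, p'` in `W`, and its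
integral over `W` with respect to arclength is `1`. -/
structure IsReferenceDensity {n : ℕ} (f : TorusDiffeo n) (E : Cover n → Submodule ℝ (Cover n))
    (γ : ℝ → Cover n) (J : Set ℝ) (ρ : Cover n → ℝ) : Prop where
  pos : ∀ p ∈ γ '' J, 0 < ρ p
  ratio : ∀ p ∈ γ '' J, ∀ p' ∈ γ '' J,
    Tendsto (fun k : ℕ => ∏ i ∈ Finset.Icc 1 k,
      dilation f E (f.lift.symm^[i] p') / dilation f E (f.lift.symm^[i] p)) atTop
      (𝓝 (ρ p / ρ p'))
  integral_eq_one : arcIntegral γ J ρ = 1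

/-! ### The coupled system and the contracting center condition -/

/-- The data of the coupled system and its standing assumptions. -/
structure CoupledSystem where
  /-- the base map, its hyperbolicity constant `λ_A` and its splitting -/
  A : TorusDiffeo 2
  lam : ℝ
  Es : Torus 2 → Submodule ℝ (Cover 2)
  Eu : Torus 2 → Submodule ℝ (Cover 2)
  anosov : IsAnosov A lam Es Eu
  /-- the fiber map with its repelling and attracting fixed points -/
  g : CircleDiffeo
  zr : UnitAddCircle
  za : UnitAddCircle
  northSouth : IsNorthSouth g zr za
  /-- the amount of rotation -/
  r : CircleDiffeo
  /-- domination: `λ_A < λ_g^min < 1 < λ_g^max < λ_A⁻¹` -/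
  lam_lt : lam < g.deriv za
  min_lt_one : g.deriv za < 1
  one_lt_max : 1 < g.deriv zr
  max_lt : g.deriv zr < lam⁻¹
  /-- bounds on the derivative of the rotation -/
  c : ℝ
  C : ℝ
  c_pos : 0 < c
  c_le : ∀ z, c ≤ r.deriv z
  le_C : ∀ z, r.deriv z ≤ C
  /-- neither direction is vertical; `du`, `ds` are the unit vectors `∂_A^u`, `∂_A^s` -/
  du : Torus 2 → Cover 2
  ds : Torus 2 → Cover 2
  du_mem : ∀ p, du p ∈ Eu p
  ds_mem : ∀ p, ds p ∈ Es p
  norm_du : ∀ p, ‖du p‖ = 1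
  norm_ds : ∀ p, ‖ds p‖ = 1
  β : ℝ
  β_pos : 0 < β
  β_le : ∀ p, β ≤ du p 0
  ds_neg : ∀ p, ds p 0 < 0
  /-- the coefficients `α^u`, `α^s`, both positive -/
  αu : Torus 2 → ℝ
  αs : Torus 2 → ℝ
  αu_pos : ∀ p, 0 < αu p
  αs_pos : ∀ p, 0 < αs p
  map_du : ∀ x : Cover 2,
    fderiv ℝ A.lift x (du (proj x)) = αu (proj x) • du (A.toEquiv (proj x))
  map_ds : ∀ x : Cover 2,
    fderiv ℝ A.lift x (ds (proj x)) = αs (proj x) • ds (A.toEquiv (proj x))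

namespace CoupledSystem

variable (S : CoupledSystem)

/-- The coupled map `F(x, y, z) = (A(x, y), g(z + r(x)))`. -/
def F : TorusDiffeo 3 := skewProduct S.A S.g S.r

/-- `λ_g^max = max g' = g'(z_r)` -/
def lamMax : ℝ := S.g.deriv S.zr

/-- `α^u_min`, the minimum of `α^u` -/
def αuMin : ℝ := ⨅ p, S.αu p

/-- The unstable field `E^u` of `F`. -/
def Euf : Cover 3 → Submodule ℝ (Cover 3) := unstableSpace S.F S.lam

/-- The center field `E^c = ⟨∂_z⟩`. -/
def Ec : Cover 3 → Submodule ℝ (Cover 3) :=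
  fun _ => Submodule.span ℝ {EuclideanSpace.single 2 1}

/-- `V = γ(J)` is a fundamental domain: a bounded piece of a `W^u`-curve of `F` with
`π_z(V) = ℝ/ℤ`, no proper subset of which has this property. -/
structure IsFundamentalDomain (γ : ℝ → Cover 3) (J : Set ℝ) : Prop where
  curve : IsTangentCurve S.Euf γ
  ordConnected : J.OrdConnected
  bounded : Bornology.IsBounded J
  surj : vertical '' (γ '' J) = univ
  minimal : ∀ V, V ⊂ γ '' J → vertical '' V ≠ univ

/-- The contracting center condition: there is `c₁ > 0` with
`∫_{F⁻¹V} log ‖DF_p|_{E^c}‖ dμ_{F⁻¹V}(p) ≤ -c₁` for all fundamental domains `V`, where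
`dμ_W = ρ_W dm_W`. The existence of `ρ_{F⁻¹V}`, which is unique, is a part of the condition. -/
def ContractingCenter : Prop :=
  ∃ c₁ : ℝ, 0 < c₁ ∧ ∀ (γ : ℝ → Cover 3) (J : Set ℝ), S.IsFundamentalDomain γ J →
    ∃ ρ : Cover 3 → ℝ, IsReferenceDensity S.F S.Euf (S.F.lift.symm ∘ γ) J ρ ∧
      arcIntegral (S.F.lift.symm ∘ γ) J
        (fun p => Real.log (dilation S.F Ec p) * ρ p) ≤ -c₁

/-- `K` is a distortion constant `K_A` for `A`: `ρ_W(p)/ρ_W(p') ≤ K` for the reference densities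
of `A` on the segments `W = A⁻¹(π_xy V) = π_xy(F⁻¹V)` of unstable leaves of `A`, where `V` is a
fundamental domain. -/
def IsDistortionConstant (K : ℝ) : Prop :=
  ∀ (γ : ℝ → Cover 3) (J : Set ℝ), S.IsFundamentalDomain γ J →
    ∀ ρ : Cover 2 → ℝ,
      IsReferenceDensity S.A (fun x => S.Eu (proj x)) (horizontal ∘ S.F.lift.symm ∘ γ) J ρ →
      ∀ p ∈ (horizontal ∘ S.F.lift.symm ∘ γ) '' J, ∀ p' ∈ (horizontal ∘ S.F.lift.symm ∘ γ) '' J,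
        ρ p / ρ p' ≤ K

/-- The weighted mean of `log g'` that has to be negative; the integrals are over
`I⁺ = {g' ≥ 1}` and `I⁻ = {g' < 1}`. -/
def weightedMean (K : ℝ) : ℝ :=
  (S.C * K ^ 2 / (S.c * S.β) * (1 + 2 * S.lamMax / (S.αuMin - S.lamMax))) *
      (∫ s in {s : UnitAddCircle | 1 ≤ S.g.deriv s}, Real.log (S.g.deriv s)) +
    ∫ s in {s : UnitAddCircle | S.g.deriv s < 1}, Real.log (S.g.deriv s)

end CoupledSystem

/-! ### The linear example -/

/-- The linear diffeomorphism of the 2-torus with matrix `[[N, N - 1], [1, 1]]`. -/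
def linearBase (N : ℕ) : TorusDiffeo 2 where
  toEquiv :=
    { toFun := fun p => ![(N : ℤ) • p 0 + ((N : ℤ) - 1) • p 1, p 0 + p 1]
      invFun := fun q => ![q 0 - ((N : ℤ) - 1) • q 1, (N : ℤ) • q 1 - q 0]
      left_inv := by
        intro p; ext i; fin_cases i <;> simp <;> module
      right_inv := by
        intro p; ext i; fin_cases i <;> simp <;> module }
  lift :=
    { toFun := fun x => !₂[(N : ℝ) * x 0 + ((N : ℝ) - 1) * x 1, x 0 + x 1]
      invFun := fun y => !₂[y 0 - ((N : ℝ) - 1) * y 1, (N : ℝ) * y 1 - y 0]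
      left_inv := by
        intro p; ext i; fin_cases i <;> simp <;> ring
      right_inv := by
        intro p; ext i; fin_cases i <;> simp <;> ring }
  proj_lift := by
    intro x
    ext i
    fin_cases i
    · change ((((N : ℝ) * x 0 + ((N : ℝ) - 1) * x 1 : ℝ)) : UnitAddCircle)
        = (N : ℤ) • (x 0 : UnitAddCircle) + ((N : ℤ) - 1) • (x 1 : UnitAddCircle)
      rw [← AddCircle.coe_zsmul, ← AddCircle.coe_zsmul, ← AddCircle.coe_add]
      simp
    · exact AddCircle.coe_add _ _ _
  contDiff_lift := by
    rw [contDiff_euclidean]; intro i; fin_cases i <;> simp <;> fun_prop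
  contDiff_lift_symm := by
    rw [contDiff_euclidean]; intro i; fin_cases i <;> simp <;> fun_prop

end SkewCoupling

end

/-!
The skew product maps the line over `E^u_A` of slope `h` at `p` to the line of slope `g' / α^u *
(h + r' ∂_A^u·∂_x)` at `F p`. As `g' / α^u ≤ λ_g^max / α^u_min < 1`, there is exactly one bounded
invariant slope, a convergent sum over the backward orbit (`slope`), and `0 < slope ≤ C λ_g^max /
(α^u_min - λ_g^max)` (`slope_le`). The strong unstable space is the line spanned by `duF = (∂_A^u,
slope)` (`Euf_eq_span`), which `F` stretches by `α^u ‖duF ∘ F‖ / ‖duF‖` (`dilation_unstable`), so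
that the products in the definition of the reference density telescope to those of the base. Hence
the reference measure of an unstable segment `W` of `F` projects to the one of the projected
segment for `A` (`exists_isReferenceDensity`).

Both densities exist because unstable directions are Lipschitz along unstable curves
(`exists_regularity`): measured in the frame `(∂_A^u, ∂_A^s)`, whose angle is bounded below, the
difference of the unstable directions at two points contracts by the factor `α^s / α^u` under `A`,
up to an error of the order of the distance, and distances along an unstable curve decay
exponentially in backward time.

Let `W = F⁻¹V` for a fundamental domain `V`. The derivative of `F` along the fiber is `g'` at the
phase `s = z + r(x)`, and by minimality the phase meets every point of the circle exactly once
along `W` (`IsFundamentalDomain.bijOn`). With respect to the arclength `m` of the projected curve,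
`ds/dm = slope + r' ∂_A^u·∂_x` lies between `c β` and `C (1 + λ_g^max / (α^u_min - λ_g^max))`,
while the reference density varies by a factor of at most `K_A` from its value at a fixed point.
So the reference measure has a density with respect to `ds` whose supremum is at most the weight
`R = (C K_A² / (c β)) (1 + 2 λ_g^max / (α^u_min - λ_g^max))` times a lower bound `m₀` of it.
Bounding the density from above where `log g' ≥ 0` and from below elsewhere gives at most `m₀`
times the weighted mean; and `m₀ ≥ 1 / R` as the total mass is one
(`IsFundamentalDomain.exists_density`).

In the linear example the reference densities are constant, so `K_A = 1`, and the weight tends to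
one as the expansion grows. The weighted mean then tends to `∫ log g'`, which is negative by
Jensen's inequality since `∫ g' = 1` and a map of north-south type is not a rotation.
-/

noncomputable section

namespace SkewCoupling

/-! ### Differentials of torus diffeomorphisms -/

theorem proj_surjective {n : ℕ} : Function.Surjective (proj : Cover n → Torus n) := by
  intro p
  choose f hf using fun i => QuotientAddGroup.mk_surjective (p i)
  exact ⟨WithLp.toLp 2 f, funext hf⟩

theorem proj_eq_proj_iff {n : ℕ} {x y : Cover n} :
    proj x = proj y ↔ ∀ i, ∃ m : ℤ, (m : ℝ) = x i - y i := by
  rw [funext_iff]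
  refine forall_congr' fun i => ?_
  change ((x i : ℝ) : UnitAddCircle) = ((y i : ℝ) : UnitAddCircle) ↔ _
  rw [← sub_eq_zero, ← AddCircle.coe_sub, AddCircle.coe_eq_zero_iff]
  simp

/-- A continuous function on the cover that descends to the torus is bounded. -/
theorem exists_bound_of_continuous {n : ℕ} {X : Type*} [SeminormedAddCommGroup X]
    {f : Cover n → X} (hf : Continuous f) (hper : ∀ x y, proj x = proj y → f x = f y) :
    ∃ M, 0 < M ∧ ∀ x, ‖f x‖ ≤ M := by
  have hK : IsCompact ((fun v : Fin n → ℝ => (WithLp.toLp 2 v : Cover n)) ''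
      Set.pi univ fun _ => Icc (0 : ℝ) 1) :=
    (isCompact_univ_pi fun _ => isCompact_Icc).image (PiLp.continuous_toLp 2 _)
  obtain ⟨M, hM⟩ := hK.exists_bound_of_continuousOn hf.continuousOn
  refine ⟨max M 1, by positivity, fun x => ?_⟩
  have hx : proj (WithLp.toLp 2 fun i => Int.fract (x i) : Cover n) = proj x := by
    rw [proj_eq_proj_iff]
    intro i
    refine ⟨-⌊x i⌋, ?_⟩
    have := Int.self_sub_floor (x i)
    push_cast
    linarith
  rw [← hper _ _ hx]
  exact (hM _ ⟨_, fun i _ => ⟨Int.fract_nonneg _, (Int.fract_lt_one _).le⟩, rfl⟩).trans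
    (le_max_left _ _)

namespace TorusDiffeo

variable {n : ℕ} (f : TorusDiffeo n)

theorem differentiable_lift : Differentiable ℝ f.lift := f.contDiff_lift.differentiable (by simp)

theorem differentiable_lift_symm : Differentiable ℝ f.lift.symm :=
  f.contDiff_lift_symm.differentiable (by simp)

theorem proj_lift_eq {x y : Cover n} (h : proj x = proj y) : proj (f.lift x) = proj (f.lift y) := by
  rw [f.proj_lift, f.proj_lift, h]

/-- The differential of a lift is invariant under deck transformations. -/
theorem fderiv_lift_eq {x y : Cover n} (h : proj x = proj y) :
    fderiv ℝ f.lift x = fderiv ℝ f.lift y := by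
  have hv : ∀ z, proj (z + (x - y)) = proj z := by
    intro z
    rw [proj_eq_proj_iff] at h ⊢
    intro i
    obtain ⟨m, hm⟩ := h i
    exact ⟨m, by simp [hm]⟩
  have hint : ∀ i z, ∃ m : ℤ, (m : ℝ) = f.lift (z + (x - y)) i - f.lift z i := fun i z =>
    proj_eq_proj_iff.1 (f.proj_lift_eq (hv z)) i
  choose m hm using hint
  have hc : Continuous f.lift := f.contDiff_lift.continuous
  have hconst : ∀ i z, m i z = m i 0 := by
    intro i z
    have hcm : Continuous (m i) := by
      have h1 : Continuous fun z => ((m i z : ℤ) : ℝ) := by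
        simp only [hm]
        fun_prop
      exact Int.isClosedEmbedding_coe_real.isEmbedding.continuous_iff.2 h1
    exact PreconnectedSpace.constant inferInstance hcm
  have heq : (fun z => f.lift (z + (x - y)))
      = fun z => f.lift z + (WithLp.toLp 2 fun i => (m i 0 : ℝ)) := by
    funext z
    ext i
    have := hm i z
    rw [hconst i z] at this
    simp only [PiLp.add_apply, this]
    ring
  have h1 := fderiv_comp_add_right (𝕜 := ℝ) (f := f.lift) (x := y) (x - y)
  rw [heq, fderiv_add_const, add_sub_cancel] at h1
  exact h1.symm

theorem exists_norm_fderiv_le : ∃ M, 0 < M ∧ ∀ x, ‖fderiv ℝ f.lift x‖ ≤ M :=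
  exists_bound_of_continuous (f.contDiff_lift.continuous_fderiv (by simp))
    fun _ _ h => f.fderiv_lift_eq h

theorem exists_lipschitz_fderiv :
    ∃ L, 0 < L ∧ ∀ x y, ‖fderiv ℝ f.lift x - fderiv ℝ f.lift y‖ ≤ L * ‖x - y‖ := by
  have hC : ContDiff ℝ 1 (fderiv ℝ f.lift) := f.contDiff_lift.fderiv_right (by norm_num)
  obtain ⟨L, hL, hb⟩ := exists_bound_of_continuous
    (hC.continuous_fderiv (by simp)) (f := fderiv ℝ (fderiv ℝ f.lift)) (by
      intro x y h
      have heq : (fun z => fderiv ℝ f.lift (z + (x - y))) = fderiv ℝ f.lift := by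
        funext z
        refine f.fderiv_lift_eq ?_
        rw [proj_eq_proj_iff] at h ⊢
        intro i
        obtain ⟨m, hm⟩ := h i
        exact ⟨m, by simp [hm]⟩
      have h1 := fderiv_comp_add_right (𝕜 := ℝ) (f := fderiv ℝ f.lift) (x := y) (x - y)
      rw [heq, add_sub_cancel] at h1
      exact h1.symm)
  exact ⟨L, hL, fun x y => convex_univ.norm_image_sub_le_of_norm_fderiv_le
    (fun z _ => (hC.differentiable (by simp)) z) (fun z _ => hb z) (mem_univ y) (mem_univ x)⟩

theorem fderiv_symm_apply_fderiv (x v : Cover n) :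
    fderiv ℝ f.lift.symm (f.lift x) (fderiv ℝ f.lift x v) = v := by
  have h := (f.differentiable_lift_symm (f.lift x)).hasFDerivAt.comp x
    (f.differentiable_lift x).hasFDerivAt
  have h2 : (f.lift.symm ∘ f.lift : Cover n → Cover n) = id := by
    funext z; simp
  rw [h2] at h
  have := congrArg (fun T => T v) (h.unique (hasFDerivAt_id x))
  simpa using this

theorem differentiable_iterate_symm (k : ℕ) : Differentiable ℝ (f.lift.symm^[k]) :=
  f.differentiable_lift_symm.iterate k

variable {f} {X : Cover n → Cover n} {m : Cover n → ℝ}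

theorem fderiv_symm_of_invariant (hm : ∀ x, m x ≠ 0)
    (h : ∀ x, fderiv ℝ f.lift x (X x) = m x • X (f.lift x)) (x : Cover n) :
    fderiv ℝ f.lift.symm x (X x) = (m (f.lift.symm x))⁻¹ • X (f.lift.symm x) := by
  have h1 := f.fderiv_symm_apply_fderiv (f.lift.symm x) (X (f.lift.symm x))
  rw [h, Equiv.apply_symm_apply, map_smul] at h1
  rw [← h1, smul_smul, inv_mul_cancel₀ (hm _), one_smul]

/-- An invariant line field with multiplier `m` is transported by `f⁻ᵏ` with the inverse of the
product of the multipliers along the backward orbit. -/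
theorem fderiv_iterate_symm_of_invariant (hm : ∀ x, m x ≠ 0)
    (h : ∀ x, fderiv ℝ f.lift x (X x) = m x • X (f.lift x)) (k : ℕ) (x : Cover n) :
    fderiv ℝ (f.lift.symm^[k]) x (X x)
      = (∏ i ∈ Finset.Icc 1 k, m (f.lift.symm^[i] x))⁻¹ • X (f.lift.symm^[k] x) := by
  induction k with
  | zero => simp
  | succ k ih =>
    have h1 : fderiv ℝ (f.lift.symm^[k + 1]) x
        = (fderiv ℝ f.lift.symm (f.lift.symm^[k] x)).comp (fderiv ℝ (f.lift.symm^[k]) x) := by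
      rw [Function.iterate_succ']
      exact fderiv_comp x (f.differentiable_lift_symm _) (f.differentiable_iterate_symm k x)
    rw [h1, ContinuousLinearMap.comp_apply, ih, map_smul, fderiv_symm_of_invariant hm h,
      smul_smul, Finset.prod_Icc_succ_top (by omega), mul_inv, Function.iterate_succ_apply']

end TorusDiffeo

/-- The dilation along a line field spanned by a field `X` with multiplier `m`. -/
theorem dilation_eq_of_span {n : ℕ} {f : TorusDiffeo n} {E : Cover n → Submodule ℝ (Cover n)}
    {X : Cover n → Cover n} {x : Cover n} {a : ℝ} (hE : E x = Submodule.span ℝ {X x})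
    (hX : X x ≠ 0) (h : fderiv ℝ f.lift x (X x) = a • X (f.lift x)) :
    dilation f E x = |a| * ‖X (f.lift x)‖ / ‖X x‖ := by
  have hpos : 0 < ‖X x‖ := norm_pos_iff.2 hX
  unfold dilation
  refine ContinuousLinearMap.opNorm_eq_of_bounds (by positivity) ?_ ?_
  · rintro ⟨v, hv⟩
    rw [hE, Submodule.mem_span_singleton] at hv
    obtain ⟨b, rfl⟩ := hv
    simp only [ContinuousLinearMap.comp_apply, Submodule.subtypeL_apply, map_smul, h, norm_smul,
      Submodule.coe_norm, Real.norm_eq_abs]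
    field_simp
    rfl
  · intro N _ hb
    have := hb ⟨X x, hE ▸ Submodule.mem_span_singleton_self _⟩
    simp only [ContinuousLinearMap.comp_apply, Submodule.subtypeL_apply, h, norm_smul,
      Submodule.coe_norm, Real.norm_eq_abs] at this
    rwa [div_le_iff₀ hpos]

/-! ### Circle diffeomorphisms -/

namespace CircleDiffeo

variable (g : CircleDiffeo)

theorem differentiable_lift : Differentiable ℝ g.lift := g.contDiff_lift.differentiable (by simp)

theorem hasDerivAt_lift (x : ℝ) : HasDerivAt g.lift (g.deriv (x : UnitAddCircle)) x := by
  rw [g.deriv_coe]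
  exact (g.differentiable_lift x).hasDerivAt

theorem contDiff_deriv_lift : ContDiff ℝ 1 (_root_.deriv g.lift) := by
  have h := g.contDiff_lift
  rw [show (2 : WithTop ℕ∞) = 1 + 1 by norm_num, contDiff_succ_iff_deriv] at h
  exact h.2.2

theorem deriv_pos (z : UnitAddCircle) : 0 < g.deriv z := by
  obtain ⟨x, rfl⟩ := QuotientAddGroup.mk_surjective z
  have := g.deriv_lift_pos x
  rwa [← g.deriv_coe] at this

theorem continuous_deriv : Continuous g.deriv := by
  have h : Continuous fun x : ℝ => g.deriv (x : UnitAddCircle) := by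
    simp only [g.deriv_coe]
    exact g.contDiff_deriv_lift.continuous
  exact (QuotientAddGroup.isQuotientMap_mk (N := AddSubgroup.zmultiples (1 : ℝ))).continuous_iff.2 h

theorem exists_lipschitz_deriv :
    ∃ L, 0 < L ∧ ∀ x y : ℝ, |g.deriv (x : UnitAddCircle) - g.deriv (y : UnitAddCircle)|
      ≤ L * |x - y| := by
  have hper : Function.Periodic (_root_.deriv (_root_.deriv g.lift)) 1 := by
    intro x
    rw [← deriv_comp_add_const (f := _root_.deriv g.lift) 1 x]
    congr 1
    exact funext g.deriv_lift_periodic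
  have hc : Continuous (_root_.deriv (_root_.deriv g.lift)) :=
    g.contDiff_deriv_lift.continuous_deriv le_rfl
  obtain ⟨L, hL⟩ := (hper.isBounded_of_continuous one_ne_zero hc).exists_norm_le
  refine ⟨max L 1, by positivity, fun x y => ?_⟩
  rw [g.deriv_coe, g.deriv_coe]
  exact convex_univ.norm_image_sub_le_of_norm_deriv_le
    (fun z _ => (g.contDiff_deriv_lift.differentiable (by simp)) z)
    (fun z _ => (hL _ (mem_range_self z)).trans (le_max_left _ _)) (mem_univ y) (mem_univ x)

end CircleDiffeo

/-! ### Elementary estimates -/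

/-- A bounded sequence that is determined by its future up to a factor `θ < 1` and errors of
order `lamʲ` is itself of order `lamʲ`. -/
theorem le_of_le_mul_succ_add {e : ℕ → ℝ} {θ lam c B : ℝ} (hθ0 : 0 ≤ θ) (hθ1 : θ < 1)
    (hl0 : 0 ≤ lam) (hl1 : lam ≤ 1) (hc : 0 ≤ c) (h : ∀ j, e j ≤ θ * e (j + 1) + c * lam ^ j)
    (hB : ∀ j, e j ≤ B) (j : ℕ) : e j ≤ c / (1 - θ) * lam ^ j := by
  have hθ : 0 < 1 - θ := by linarith
  have key : ∀ n j, e j ≤ θ ^ n * B + c / (1 - θ) * lam ^ j := by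
    intro n
    induction n with
    | zero =>
      intro j
      have : 0 ≤ c / (1 - θ) * lam ^ j := by positivity
      simpa using (hB j).trans (by linarith)
    | succ n ih =>
      intro j
      have h1 : lam ^ (j + 1) ≤ lam ^ j := pow_le_pow_of_le_one hl0 hl1 (Nat.le_succ j)
      have h2 : θ * (c / (1 - θ) * lam ^ (j + 1)) ≤ θ * (c / (1 - θ) * lam ^ j) := by gcongr
      have h3 : θ * (c / (1 - θ) * lam ^ j) + c * lam ^ j = c / (1 - θ) * lam ^ j := by
        field_simp; ring
      have h4 := mul_le_mul_of_nonneg_left (ih (j + 1)) hθ0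
      have h5 := h j
      rw [pow_succ]
      linarith
  have hlim : Tendsto (fun n : ℕ => θ ^ n * B + c / (1 - θ) * lam ^ j) atTop
      (𝓝 (0 * B + c / (1 - θ) * lam ^ j)) :=
    ((tendsto_pow_atTop_nhds_zero_of_lt_one hθ0 hθ1).mul_const B).add_const _
  rw [zero_mul, zero_add] at hlim
  exact ge_of_tendsto' hlim fun n => key n j

/-- The same recursion with errors that merely tend to zero forces the sequence to zero. -/
theorem tendsto_zero_of_le_mul_succ_add {e ε : ℕ → ℝ} {θ B : ℝ} (hθ0 : 0 ≤ θ) (hθ1 : θ < 1)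
    (he : ∀ j, 0 ≤ e j) (h : ∀ j, e j ≤ θ * e (j + 1) + ε j) (hε : Tendsto ε atTop (𝓝 0))
    (hB : ∀ j, e j ≤ B) : Tendsto e atTop (𝓝 0) := by
  have hθ : 0 < 1 - θ := by linarith
  rw [Metric.tendsto_atTop]
  intro η hη
  obtain ⟨J, hJ⟩ := eventually_atTop.1
    (hε.eventually_lt_const (show 0 < η / 2 * (1 - θ) by positivity))
  refine ⟨J, fun j hj => ?_⟩
  have h1 := le_of_le_mul_succ_add (e := fun i => e (j + i)) (lam := 1) hθ0 hθ1 zero_le_one le_rfl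
    (c := η / 2 * (1 - θ)) (by positivity)
    (fun i => by
      simpa [add_assoc] using (h (j + i)).trans (add_le_add_right (hJ (j + i) (by omega)).le _))
    (fun i => hB _) 0
  rw [mul_div_cancel_right₀ _ hθ.ne'] at h1
  rw [Real.dist_eq, sub_zero, abs_of_nonneg (he j)]
  simp only [add_zero, pow_zero, mul_one] at h1
  linarith

theorem abs_log_sub_log_le_of_one_le {a b : ℝ} (ha : 1 ≤ a) (hb : 1 ≤ b) :
    |Real.log a - Real.log b| ≤ |a - b| := by
  have key : ∀ {a b : ℝ}, 1 ≤ a → 1 ≤ b → Real.log a - Real.log b ≤ |a - b| := by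
    intro a b ha hb
    have hb0 : 0 < b := by linarith
    rw [← Real.log_div (by linarith) hb0.ne']
    have h := Real.log_le_sub_one_of_pos (show 0 < a / b by positivity)
    have h2 : a / b - 1 = (a - b) / b := by field_simp
    rw [h2] at h
    refine h.trans ((le_abs_self _).trans ?_)
    rw [abs_div, abs_of_pos hb0]
    exact div_le_self (abs_nonneg _) hb
  rw [abs_le]
  constructor
  · have := key hb ha
    rw [abs_sub_comm] at this
    linarith
  · exact key ha hb

/-- The oriented area of the parallelogram spanned by two plane vectors. -/
def wedge (u v : Cover 2) : ℝ := u 0 * v 1 - u 1 * v 0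

theorem norm_sq_cover_two (u : Cover 2) : ‖u‖ ^ 2 = u 0 ^ 2 + u 1 ^ 2 := by
  simp [EuclideanSpace.norm_sq_eq]

theorem norm_sq_cover_three (u : Cover 3) : ‖u‖ ^ 2 = u 0 ^ 2 + u 1 ^ 2 + u 2 ^ 2 := by
  simp [EuclideanSpace.norm_sq_eq, Fin.sum_univ_three]

theorem abs_wedge_le (u v : Cover 2) : |wedge u v| ≤ ‖u‖ * ‖v‖ := by
  refine abs_le_of_sq_le_sq ?_ (by positivity)
  rw [mul_pow, norm_sq_cover_two, norm_sq_cover_two, wedge]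
  nlinarith [sq_nonneg (u 0 * v 0 + u 1 * v 1)]

theorem wedge_smul (a : ℝ) (u v : Cover 2) : wedge u (a • v) = a * wedge u v := by
  simp [wedge]; ring

theorem smul_wedge (a : ℝ) (u v : Cover 2) : wedge (a • u) v = a * wedge u v := by
  simp [wedge]; ring

theorem wedge_sub (u v w : Cover 2) : wedge u (v - w) = wedge u v - wedge u w := by
  simp [wedge]; ring

/-- A linear map multiplies areas by its determinant. -/
theorem wedge_map (T : Cover 2 →L[ℝ] Cover 2) (u v : Cover 2) :
    wedge (T u) (T v) = wedge u v *
      wedge (T (EuclideanSpace.single 0 1)) (T (EuclideanSpace.single 1 1)) := by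
  have h : ∀ w : Cover 2,
      w = w 0 • EuclideanSpace.single 0 1 + w 1 • EuclideanSpace.single 1 1 := by
    intro w; ext i; fin_cases i <;> simp
  rw [h u, h v]
  simp only [map_add, map_smul]
  simp [wedge]; ring

/-- For unit vectors the sine of the angle is controlled by the chords to `v` and to `-v`. -/
theorem norm_sub_mul_norm_add {u v : Cover 2} (hu : ‖u‖ = 1) (hv : ‖v‖ = 1) :
    ‖u - v‖ * ‖u + v‖ = 2 * |wedge u v| := by
  have h1 := norm_sq_cover_two u
  have h2 := norm_sq_cover_two v
  rw [hu] at h1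
  rw [hv] at h2
  have h3 := norm_sq_cover_two (u - v)
  have h4 := norm_sq_cover_two (u + v)
  simp only [PiLp.sub_apply, PiLp.add_apply] at h3 h4
  rw [← abs_of_nonneg (show 0 ≤ ‖u - v‖ * ‖u + v‖ by positivity), ← abs_two, ← abs_mul,
    ← sq_eq_sq_iff_abs_eq_abs, mul_pow, h3, h4, wedge]
  linear_combination (u 0 ^ 2 + u 1 ^ 2 - v 0 ^ 2 - v 1 ^ 2) * (h2 - h1)

/-! ### The base map: expansion rates and regularity along unstable leaves -/

namespace CoupledSystem

variable (S : CoupledSystem)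

theorem map_du' (x : Cover 2) : fderiv ℝ S.A.lift x (S.du (proj x))
    = S.αu (proj x) • S.du (proj (S.A.lift x)) := by
  rw [S.map_du, S.A.proj_lift]

theorem map_ds' (x : Cover 2) : fderiv ℝ S.A.lift x (S.ds (proj x))
    = S.αs (proj x) • S.ds (proj (S.A.lift x)) := by
  rw [S.map_ds, S.A.proj_lift]

theorem αs_le (p : Torus 2) : S.αs p ≤ S.lam := by
  obtain ⟨x, rfl⟩ := proj_surjective p
  have h := S.anosov.contract_stable x _ (S.ds_mem _)
  rwa [S.map_ds, norm_smul, S.norm_ds, S.norm_ds, mul_one, mul_one, Real.norm_eq_abs,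
    abs_of_pos (S.αs_pos _)] at h

theorem lam_pos : 0 < S.lam := (S.αs_pos 0).trans_le (S.αs_le 0)

theorem lam_lt_one : S.lam < 1 := S.anosov.lam_lt_one

theorem inv_lam_le_αu (p : Torus 2) : S.lam⁻¹ ≤ S.αu p := by
  obtain ⟨x, rfl⟩ := proj_surjective p
  have h := S.anosov.contract_unstable (S.A.lift x) _ (S.du_mem _)
  rw [TorusDiffeo.fderiv_symm_of_invariant (m := fun x => S.αu (proj x))
    (X := fun x => S.du (proj x)) (fun x => (S.αu_pos _).ne') S.map_du', norm_smul, S.norm_du,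
    S.norm_du, mul_one, mul_one, Equiv.symm_apply_apply, norm_inv, Real.norm_eq_abs,
    abs_of_pos (S.αu_pos _)] at h
  exact inv_le_of_inv_le₀ (S.αu_pos _) h

theorem one_lt_αu (p : Torus 2) : 1 < S.αu p :=
  (one_lt_inv₀ S.lam_pos |>.2 S.lam_lt_one).trans_le (S.inv_lam_le_αu p)

theorem αuMin_le (p : Torus 2) : S.αuMin ≤ S.αu p :=
  ciInf_le ⟨0, by rintro _ ⟨q, rfl⟩; exact (S.αu_pos q).le⟩ p

theorem inv_lam_le_αuMin : S.lam⁻¹ ≤ S.αuMin := le_ciInf S.inv_lam_le_αu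

theorem lamMax_lt_αuMin : S.lamMax < S.αuMin := S.max_lt.trans_le S.inv_lam_le_αuMin

theorem du_ne_zero (p : Torus 2) : S.du p ≠ 0 := norm_pos_iff.1 (by rw [S.norm_du]; norm_num)

theorem ds_ne_zero (p : Torus 2) : S.ds p ≠ 0 := norm_pos_iff.1 (by rw [S.norm_ds]; norm_num)

theorem Eu_eq_span (p : Torus 2) : S.Eu p = Submodule.span ℝ {S.du p} := by
  have h := S.anosov.finrank_unstable p
  exact (Submodule.eq_of_le_of_finrank_eq
    ((Submodule.span_singleton_le_iff_mem _ _).2 (S.du_mem p))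
    (by rw [finrank_span_singleton (S.du_ne_zero p), h])).symm

theorem Es_eq_span (p : Torus 2) : S.Es p = Submodule.span ℝ {S.ds p} := by
  have h := S.anosov.finrank_stable p
  exact (Submodule.eq_of_le_of_finrank_eq
    ((Submodule.span_singleton_le_iff_mem _ _).2 (S.ds_mem p))
    (by rw [finrank_span_singleton (S.ds_ne_zero p), h])).symm

theorem exists_decomposition (p : Torus 2) (v : Cover 2) :
    ∃ a b : ℝ, v = a • S.du p + b • S.ds p := by
  have h : v ∈ S.Es p ⊔ S.Eu p := by
    rw [(S.anosov.isCompl p).sup_eq_top]; trivial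
  rw [S.Es_eq_span, S.Eu_eq_span, Submodule.mem_sup] at h
  obtain ⟨_, hy, _, hz, rfl⟩ := h
  obtain ⟨b, rfl⟩ := Submodule.mem_span_singleton.1 hy
  obtain ⟨a, rfl⟩ := Submodule.mem_span_singleton.1 hz
  exact ⟨a, b, add_comm _ _⟩

theorem dilation_base (x : Cover 2) :
    dilation S.A (fun x => S.Eu (proj x)) x = S.αu (proj x) := by
  rw [dilation_eq_of_span (X := fun x => S.du (proj x)) (S.Eu_eq_span _) (S.du_ne_zero _)
    (S.map_du' x), S.norm_du, S.norm_du, abs_of_pos (S.αu_pos _), mul_one, div_one]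

/-- The angle between the stable and the unstable lines is bounded below: one step of `A`
separates `du` from `±ds` by at least `lam⁻¹ - lam`, while `‖DA‖` is bounded. -/
theorem exists_le_abs_wedge :
    ∃ δ, 0 < δ ∧ ∀ p, δ ≤ |wedge (S.du p) (S.ds p)| := by
  obtain ⟨M, hM, hb⟩ := S.A.exists_norm_fderiv_le
  have hκ : 0 < S.lam⁻¹ - S.lam := by
    have := one_lt_inv₀ S.lam_pos |>.2 S.lam_lt_one
    linarith [S.lam_lt_one]
  refine ⟨((S.lam⁻¹ - S.lam) / M) ^ 2 / 2, by positivity, fun p => ?_⟩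
  obtain ⟨x, rfl⟩ := proj_surjective p
  have hu : ‖S.αu (proj x) • S.du (proj (S.A.lift x))‖ = S.αu (proj x) := by
    rw [norm_smul, S.norm_du, mul_one, Real.norm_eq_abs, abs_of_pos (S.αu_pos _)]
  have hs : ‖S.αs (proj x) • S.ds (proj (S.A.lift x))‖ = S.αs (proj x) := by
    rw [norm_smul, S.norm_ds, mul_one, Real.norm_eq_abs, abs_of_pos (S.αs_pos _)]
  have h1 : (S.lam⁻¹ - S.lam) / M ≤ ‖S.du (proj x) - S.ds (proj x)‖ := by
    rw [div_le_iff₀' hM]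
    have h := ((fderiv ℝ S.A.lift x).le_opNorm (S.du (proj x) - S.ds (proj x))).trans
      (mul_le_mul_of_nonneg_right (hb x) (norm_nonneg _))
    rw [map_sub, S.map_du', S.map_ds'] at h
    have h' := norm_sub_norm_le (S.αu (proj x) • S.du (proj (S.A.lift x)))
      (S.αs (proj x) • S.ds (proj (S.A.lift x)))
    rw [hu, hs] at h'
    linarith [S.inv_lam_le_αu (proj x), S.αs_le (proj x)]
  have h2 : (S.lam⁻¹ - S.lam) / M ≤ ‖S.du (proj x) + S.ds (proj x)‖ := by
    rw [div_le_iff₀' hM]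
    have h := ((fderiv ℝ S.A.lift x).le_opNorm (S.du (proj x) + S.ds (proj x))).trans
      (mul_le_mul_of_nonneg_right (hb x) (norm_nonneg _))
    rw [map_add, S.map_du', S.map_ds'] at h
    have h' := norm_sub_le_norm_add (S.αu (proj x) • S.du (proj (S.A.lift x)))
      (S.αs (proj x) • S.ds (proj (S.A.lift x)))
    rw [hu, hs] at h'
    linarith [S.inv_lam_le_αu (proj x), S.αs_le (proj x)]
  have h3 := norm_sub_mul_norm_add (S.norm_du (proj x)) (S.norm_ds (proj x))
  have h4 := mul_le_mul h1 h2 (by positivity) (norm_nonneg _)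
  rw [sq]
  linarith

/-- One step of the graph transform for the unstable direction: the component of `du y` along
`ds x`, computed in the frame at `x`, shrinks by the factor `αs / αu`, up to an error of the
order of the distance of `x` and `y`. -/
theorem αu_mul_wedge_div (x y : Cover 2) :
    S.αu (proj y) * (wedge (S.du (proj (S.A.lift x))) (S.du (proj (S.A.lift y)))
      / wedge (S.du (proj (S.A.lift x))) (S.ds (proj (S.A.lift x))))
    = S.αs (proj x) * (wedge (S.du (proj x)) (S.du (proj y))
      / wedge (S.du (proj x)) (S.ds (proj x)))
      + wedge (S.du (proj (S.A.lift x)))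
          ((fderiv ℝ S.A.lift y - fderiv ℝ S.A.lift x) (S.du (proj y)))
        / wedge (S.du (proj (S.A.lift x))) (S.ds (proj (S.A.lift x))) := by
  obtain ⟨δ, hδ, hw⟩ := S.exists_le_abs_wedge
  have hD : ∀ p, wedge (S.du p) (S.ds p) ≠ 0 := fun p => abs_pos.1 (hδ.trans_le (hw p))
  have h1 := wedge_map (fderiv ℝ S.A.lift x) (S.du (proj x)) (S.ds (proj x))
  have h2 := wedge_map (fderiv ℝ S.A.lift x) (S.du (proj x)) (S.du (proj y))
  rw [S.map_du', S.map_ds', smul_wedge, wedge_smul] at h1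
  rw [S.map_du', smul_wedge] at h2
  rw [sub_apply, wedge_sub, S.map_du', wedge_smul]
  have ha := (S.αu_pos (proj x)).ne'
  have hx := hD (proj x)
  have hx' := hD (proj (S.A.lift x))
  set D := wedge (fderiv ℝ S.A.lift x (EuclideanSpace.single 0 1))
    (fderiv ℝ S.A.lift x (EuclideanSpace.single 1 1))
  set w := wedge (S.du (proj x)) (S.du (proj y))
  have h3 : S.αs (proj x) * (w / wedge (S.du (proj x)) (S.ds (proj x)))
      = wedge (S.du (proj (S.A.lift x))) (fderiv ℝ S.A.lift x (S.du (proj y)))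
        / wedge (S.du (proj (S.A.lift x))) (S.ds (proj (S.A.lift x))) := by
    field_simp
    apply mul_left_cancel₀ ha
    linear_combination w * h1 - wedge (S.du (proj x)) (S.ds (proj x)) * h2
  rw [h3]
  ring

/-- Unstable directions and expansion rates are Lipschitz along pairs of points whose backward
orbits approach each other at the rate `lam`. The constant does not depend on the points. -/
theorem exists_regularity : ∃ c, 0 < c ∧ ∀ (d : ℝ) (x y : Cover 2), 0 ≤ d →
    (∀ i, ‖S.A.lift.symm^[i] x - S.A.lift.symm^[i] y‖ ≤ d * S.lam ^ i) → ∀ j,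
    ‖S.du (proj (S.A.lift.symm^[j] x)) - S.du (proj (S.A.lift.symm^[j] y))‖
        ≤ c * (d * S.lam ^ j) ∧
    |S.αu (proj (S.A.lift.symm^[j] x)) - S.αu (proj (S.A.lift.symm^[j] y))|
        ≤ c * (d * S.lam ^ j) := by
  obtain ⟨δ, hδ, hw⟩ := S.exists_le_abs_wedge
  obtain ⟨M, hM, hMb⟩ := S.A.exists_norm_fderiv_le
  obtain ⟨L, hL, hLb⟩ := S.A.exists_lipschitz_fderiv
  have hl0 := S.lam_pos
  have hl1 := S.lam_lt_one
  have h1l : 0 < 1 - S.lam := by linarith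
  have hβ := S.β_pos
  set c₁ := L / δ / (1 - S.lam) / S.β with hc₁
  have hc₁0 : 0 < c₁ := by positivity
  have hdu : ∀ (d : ℝ) (x y : Cover 2), 0 ≤ d →
      (∀ i, ‖S.A.lift.symm^[i] x - S.A.lift.symm^[i] y‖ ≤ d * S.lam ^ i) → ∀ j,
      ‖S.du (proj (S.A.lift.symm^[j] x)) - S.du (proj (S.A.lift.symm^[j] y))‖
        ≤ c₁ * (d * S.lam ^ j) := by
    intro d x y hd hxy j
    have hwle : ∀ p q, |wedge (S.du p) (S.du q)| ≤ 1 := fun p q => by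
      simpa [S.norm_du] using abs_wedge_le (S.du p) (S.du q)
    -- the component along `ds` obeys the contracting recursion, with an error of order `lamʲ`
    have key := le_of_le_mul_succ_add (e := fun j =>
        |wedge (S.du (proj (S.A.lift.symm^[j] x))) (S.du (proj (S.A.lift.symm^[j] y)))
          / wedge (S.du (proj (S.A.lift.symm^[j] x))) (S.ds (proj (S.A.lift.symm^[j] x)))|)
      (θ := S.lam) (lam := S.lam) (c := L / δ * d) (B := 1 / δ) hl0.le hl1 hl0.le hl1.le
      (by positivity) (by
        intro j
        have hx : S.A.lift.symm^[j] x = S.A.lift (S.A.lift.symm^[j + 1] x) := by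
          rw [Function.iterate_succ_apply', Equiv.apply_symm_apply]
        have hy : S.A.lift.symm^[j] y = S.A.lift (S.A.lift.symm^[j + 1] y) := by
          rw [Function.iterate_succ_apply', Equiv.apply_symm_apply]
        have h := S.αu_mul_wedge_div (S.A.lift.symm^[j + 1] x) (S.A.lift.symm^[j + 1] y)
        rw [← hx, ← hy] at h
        have h' := congrArg abs h
        rw [abs_mul, abs_of_pos (S.αu_pos _)] at h'
        have herr : |wedge (S.du (proj (S.A.lift.symm^[j] x)))
            ((fderiv ℝ S.A.lift (S.A.lift.symm^[j + 1] y)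
              - fderiv ℝ S.A.lift (S.A.lift.symm^[j + 1] x))
                (S.du (proj (S.A.lift.symm^[j + 1] y))))
            / wedge (S.du (proj (S.A.lift.symm^[j] x))) (S.ds (proj (S.A.lift.symm^[j] x)))|
            ≤ L / δ * d * S.lam ^ j := by
          rw [abs_div]
          have h1 := abs_wedge_le (S.du (proj (S.A.lift.symm^[j] x)))
            ((fderiv ℝ S.A.lift (S.A.lift.symm^[j + 1] y)
              - fderiv ℝ S.A.lift (S.A.lift.symm^[j + 1] x))
                (S.du (proj (S.A.lift.symm^[j + 1] y))))
          rw [S.norm_du, one_mul] at h1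
          have h2 := ContinuousLinearMap.le_opNorm (fderiv ℝ S.A.lift (S.A.lift.symm^[j + 1] y)
              - fderiv ℝ S.A.lift (S.A.lift.symm^[j + 1] x)) (S.du (proj (S.A.lift.symm^[j + 1] y)))
          rw [S.norm_du, mul_one] at h2
          have h3 := hLb (S.A.lift.symm^[j + 1] y) (S.A.lift.symm^[j + 1] x)
          have h4 := hxy (j + 1)
          rw [norm_sub_rev] at h4
          have h5 : S.lam ^ (j + 1) ≤ S.lam ^ j :=
            pow_le_pow_of_le_one hl0.le hl1.le (Nat.le_succ j)
          have h6 : L * ‖S.A.lift.symm^[j + 1] y - S.A.lift.symm^[j + 1] x‖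
              ≤ L * (d * S.lam ^ j) := by
            gcongr
            exact h4.trans (by gcongr)
          calc _ ≤ (L * (d * S.lam ^ j)) / δ := by
                gcongr
                · linarith
                · exact hw _
            _ = _ := by ring
        have hle := abs_add_le (S.αs (proj (S.A.lift.symm^[j + 1] x)) *
          (wedge (S.du (proj (S.A.lift.symm^[j + 1] x))) (S.du (proj (S.A.lift.symm^[j + 1] y)))
          / wedge (S.du (proj (S.A.lift.symm^[j + 1] x))) (S.ds (proj (S.A.lift.symm^[j + 1] x)))))
          (wedge (S.du (proj (S.A.lift.symm^[j] x)))
            ((fderiv ℝ S.A.lift (S.A.lift.symm^[j + 1] y)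
              - fderiv ℝ S.A.lift (S.A.lift.symm^[j + 1] x))
                (S.du (proj (S.A.lift.symm^[j + 1] y))))
            / wedge (S.du (proj (S.A.lift.symm^[j] x))) (S.ds (proj (S.A.lift.symm^[j] x))))
        rw [← h', abs_mul, abs_of_pos (S.αs_pos _)] at hle
        have hαs := mul_le_mul_of_nonneg_right (S.αs_le (proj (S.A.lift.symm^[j + 1] x)))
          (abs_nonneg (wedge (S.du (proj (S.A.lift.symm^[j + 1] x)))
            (S.du (proj (S.A.lift.symm^[j + 1] y)))
          / wedge (S.du (proj (S.A.lift.symm^[j + 1] x))) (S.ds (proj (S.A.lift.symm^[j + 1] x)))))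
        have hαu := mul_le_mul_of_nonneg_right (S.one_lt_αu (proj (S.A.lift.symm^[j + 1] y))).le
          (abs_nonneg (wedge (S.du (proj (S.A.lift.symm^[j] x)))
            (S.du (proj (S.A.lift.symm^[j] y)))
          / wedge (S.du (proj (S.A.lift.symm^[j] x))) (S.ds (proj (S.A.lift.symm^[j] x)))))
        rw [one_mul] at hαu
        linarith)
      (by
        intro j
        simp only [abs_div]
        gcongr
        · exact hwle _ _
        · exact hw _) j
    simp only [abs_div] at key
    have hD1 :
        |wedge (S.du (proj (S.A.lift.symm^[j] x))) (S.ds (proj (S.A.lift.symm^[j] x)))| ≤ 1 := by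
      simpa [S.norm_du, S.norm_ds] using abs_wedge_le (S.du (proj (S.A.lift.symm^[j] x)))
        (S.ds (proj (S.A.lift.symm^[j] x)))
    rw [div_le_iff₀ (hδ.trans_le (hw _))] at key
    have key2 := key.trans (mul_le_of_le_one_right (by positivity) hD1)
    -- both vectors point to the right, so that they are not close to being opposite
    have hsum : 2 * S.β ≤
        ‖S.du (proj (S.A.lift.symm^[j] x)) + S.du (proj (S.A.lift.symm^[j] y))‖ := by
      have h0 := PiLp.norm_apply_le
        (S.du (proj (S.A.lift.symm^[j] x)) + S.du (proj (S.A.lift.symm^[j] y))) 0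
      rw [PiLp.add_apply, Real.norm_eq_abs] at h0
      have := le_abs_self (S.du (proj (S.A.lift.symm^[j] x)) 0
        + S.du (proj (S.A.lift.symm^[j] y)) 0)
      linarith [S.β_le (proj (S.A.lift.symm^[j] x)), S.β_le (proj (S.A.lift.symm^[j] y))]
    have hchord := norm_sub_mul_norm_add (S.norm_du (proj (S.A.lift.symm^[j] x)))
      (S.norm_du (proj (S.A.lift.symm^[j] y)))
    have hle := mul_le_mul_of_nonneg_left hsum (norm_nonneg
      (S.du (proj (S.A.lift.symm^[j] x)) - S.du (proj (S.A.lift.symm^[j] y))))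
    rw [hchord] at hle
    have hc : c₁ * (d * S.lam ^ j) = L / δ * d / (1 - S.lam) * S.lam ^ j / S.β := by
      rw [hc₁]; ring
    rw [hc, le_div_iff₀ hβ]
    linarith
  refine ⟨c₁ + (L + M * c₁), by positivity, fun d x y hd hxy j => ⟨?_, ?_⟩⟩
  · refine (hdu d x y hd hxy j).trans ?_
    gcongr
    have : 0 < L + M * c₁ := by positivity
    linarith
  · have hnorm : ∀ z, S.αu (proj z) = ‖fderiv ℝ S.A.lift z (S.du (proj z))‖ := fun z => by
      rw [S.map_du', norm_smul, S.norm_du, mul_one, Real.norm_eq_abs, abs_of_pos (S.αu_pos _)]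
    rw [hnorm, hnorm]
    refine (abs_norm_sub_norm_le _ _).trans ?_
    set X := S.A.lift.symm^[j] x
    set Y := S.A.lift.symm^[j] y
    have hsplit : fderiv ℝ S.A.lift X (S.du (proj X)) - fderiv ℝ S.A.lift Y (S.du (proj Y))
        = (fderiv ℝ S.A.lift X - fderiv ℝ S.A.lift Y) (S.du (proj X))
          + fderiv ℝ S.A.lift Y (S.du (proj X) - S.du (proj Y)) := by
      rw [sub_apply, map_sub]; abel
    rw [hsplit]
    refine (norm_add_le _ _).trans ?_
    have h1 := ContinuousLinearMap.le_opNorm (fderiv ℝ S.A.lift X - fderiv ℝ S.A.lift Y)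
      (S.du (proj X))
    rw [S.norm_du, mul_one] at h1
    have h2 := ((fderiv ℝ S.A.lift Y).le_opNorm (S.du (proj X) - S.du (proj Y))).trans
      (mul_le_mul (hMb Y) (hdu d x y hd hxy j) (norm_nonneg _) hM.le)
    have h3 := (hLb X Y).trans (mul_le_mul_of_nonneg_left (hxy j) hL.le)
    have h4 : 0 ≤ c₁ * (d * S.lam ^ j) := by have := hl0.le; positivity
    linarith

end CoupledSystem

/-! ### The strong unstable field of the skew product -/

/-- The projection `horizontal` as a continuous linear map. -/
def horizontalL : Cover 3 →L[ℝ] Cover 2 :=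
  LinearMap.toContinuousLinearMap
    { toFun := horizontal
      map_add' := fun x y => by ext i; fin_cases i <;> simp [horizontal]
      map_smul' := fun a x => by ext i; fin_cases i <;> simp [horizontal] }

theorem horizontalL_apply (p : Cover 3) : horizontalL p = horizontal p := rfl

theorem horizontal_zero (p : Cover 3) : horizontal p 0 = p 0 := rfl

theorem horizontal_one (p : Cover 3) : horizontal p 1 = p 1 := rfl

theorem horizontal_smul (a : ℝ) (p : Cover 3) : horizontal (a • p) = a • horizontal p :=
  horizontalL.map_smul a p

theorem ext_horizontal {p q : Cover 3} (h : horizontal p = horizontal q) (h2 : p 2 = q 2) :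
    p = q := by
  ext i
  fin_cases i
  · exact congrArg (fun v => v 0) h
  · exact congrArg (fun v => v 1) h
  · exact h2

theorem norm_sq_eq_horizontal (p : Cover 3) : ‖p‖ ^ 2 = ‖horizontal p‖ ^ 2 + p 2 ^ 2 := by
  rw [norm_sq_cover_three, norm_sq_cover_two, horizontal_zero, horizontal_one]

theorem norm_horizontal_le (p : Cover 3) : ‖horizontal p‖ ≤ ‖p‖ := by
  refine le_of_sq_le_sq ?_ (norm_nonneg _)
  rw [norm_sq_eq_horizontal]
  nlinarith [sq_nonneg (p 2)]

namespace CoupledSystem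

variable (S : CoupledSystem)

/-- The lift of the point of the fiber at which `F` applies `g`. -/
def phase (p : Cover 3) : ℝ := p 2 + S.r.lift (p 0)

theorem horizontal_F_lift (p : Cover 3) : horizontal (S.F.lift p) = S.A.lift (horizontal p) := by
  ext i; fin_cases i <;> rfl

theorem F_lift_two (p : Cover 3) : S.F.lift p 2 = S.g.lift (S.phase p) := rfl

theorem horizontal_F_lift_symm (p : Cover 3) :
    horizontal (S.F.lift.symm p) = S.A.lift.symm (horizontal p) := by
  rw [Equiv.eq_symm_apply, ← S.horizontal_F_lift, Equiv.apply_symm_apply]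

theorem horizontal_iterate (k : ℕ) (p : Cover 3) :
    horizontal (S.F.lift.symm^[k] p) = S.A.lift.symm^[k] (horizontal p) :=
  (Function.Semiconj.iterate_right (f := horizontal) S.horizontal_F_lift_symm k) p

theorem hasFDerivAt_phase (p : Cover 3) : HasFDerivAt S.phase
    (EuclideanSpace.proj (𝕜 := ℝ) (2 : Fin 3) + S.r.deriv (p 0 : ℝ) •
      EuclideanSpace.proj (𝕜 := ℝ) (0 : Fin 3)) p := by
  have h0 : HasFDerivAt (fun q : Cover 3 => q 0) (EuclideanSpace.proj (𝕜 := ℝ) (0 : Fin 3)) p :=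
    (EuclideanSpace.proj (𝕜 := ℝ) (0 : Fin 3)).hasFDerivAt
  have h2 : HasFDerivAt (fun q : Cover 3 => q 2) (EuclideanSpace.proj (𝕜 := ℝ) (2 : Fin 3)) p :=
    (EuclideanSpace.proj (𝕜 := ℝ) (2 : Fin 3)).hasFDerivAt
  exact h2.add ((S.r.hasDerivAt_lift (p 0)).comp_hasFDerivAt p h0)

theorem horizontal_fderiv (p v : Cover 3) :
    horizontal (fderiv ℝ S.F.lift p v) = fderiv ℝ S.A.lift (horizontal p) (horizontal v) := by
  have h1 := horizontalL.hasFDerivAt.comp p (S.F.differentiable_lift p).hasFDerivAt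
  have h2 := (S.A.differentiable_lift (horizontal p)).hasFDerivAt.comp p
    (f := horizontal) horizontalL.hasFDerivAt
  have h3 : (horizontalL ∘ S.F.lift : Cover 3 → Cover 2) = S.A.lift ∘ horizontal :=
    funext S.horizontal_F_lift
  rw [h3] at h1
  exact congrArg (fun T => T v) (h1.unique h2)

theorem fderiv_F_two (p v : Cover 3) : fderiv ℝ S.F.lift p v 2
    = S.g.deriv (S.phase p : ℝ) * (v 2 + S.r.deriv (p 0 : ℝ) * v 0) := by
  have h1 := (EuclideanSpace.proj (𝕜 := ℝ) (2 : Fin 3)).hasFDerivAt.comp p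
    (S.F.differentiable_lift p).hasFDerivAt
  have h2 := (S.g.hasDerivAt_lift (S.phase p)).comp_hasFDerivAt p (S.hasFDerivAt_phase p)
  exact congrArg (fun T => T v) (h1.unique h2)

theorem horizontal_fderiv_iterate_symm (k : ℕ) (p v : Cover 3) :
    horizontal (fderiv ℝ (S.F.lift.symm^[k]) p v)
      = fderiv ℝ (S.A.lift.symm^[k]) (horizontal p) (horizontal v) := by
  have h1 := horizontalL.hasFDerivAt.comp p (S.F.differentiable_iterate_symm k p).hasFDerivAt
  have h2 := (S.A.differentiable_iterate_symm k (horizontal p)).hasFDerivAt.comp p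
    (f := horizontal) horizontalL.hasFDerivAt
  have h3 : (horizontalL ∘ S.F.lift.symm^[k] : Cover 3 → Cover 2)
      = S.A.lift.symm^[k] ∘ horizontal :=
    funext (S.horizontal_iterate k)
  rw [h3] at h1
  exact congrArg (fun T => T v) (h1.unique h2)

/-- The factor by which `F` multiplies the slope of a line over `E^u_A`. -/
def slopeFactor (p : Cover 3) : ℝ := S.g.deriv (S.phase p : ℝ) / S.αu (proj (horizontal p))

/-- The shear that `z ↦ z + r(x)` adds to the slope of a line over `E^u_A`. -/
def shear (p : Cover 3) : ℝ := S.r.deriv (p 0 : ℝ) * S.du (proj (horizontal p)) 0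

/-- The slope `h` of the strong unstable line `⟨(∂_A^u, h)⟩` of `F`, as the sum of the shears along
the backward orbit, each multiplied by the slope factors passed since. -/
def slope (p : Cover 3) : ℝ :=
  ∑' k : ℕ, (∏ i ∈ Finset.range (k + 1), S.slopeFactor (S.F.lift.symm^[i + 1] p)) *
    S.shear (S.F.lift.symm^[k + 1] p)

/-- The ratio `λ_g^max / α^u_min` of the largest fiber expansion to the smallest base expansion. -/
def domination : ℝ := S.lamMax / S.αuMin

theorem lamMax_pos : 0 < S.lamMax := S.g.deriv_pos _

theorem deriv_g_le (z : UnitAddCircle) : S.g.deriv z ≤ S.lamMax := S.northSouth.deriv_le z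

theorem αuMin_pos : 0 < S.αuMin := S.lamMax_pos.trans S.lamMax_lt_αuMin

theorem domination_pos : 0 < S.domination := div_pos S.lamMax_pos S.αuMin_pos

theorem domination_lt_one : S.domination < 1 :=
  (div_lt_one S.αuMin_pos).2 S.lamMax_lt_αuMin

theorem slopeFactor_pos (p : Cover 3) : 0 < S.slopeFactor p :=
  div_pos (S.g.deriv_pos _) (S.αu_pos _)

theorem slopeFactor_le (p : Cover 3) : S.slopeFactor p ≤ S.domination :=
  div_le_div₀ S.lamMax_pos.le (S.deriv_g_le _) S.αuMin_pos (S.αuMin_le _)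

theorem C_pos : 0 < S.C := (S.c_pos.trans_le (S.c_le 0)).trans_le (S.le_C 0)

theorem du_zero_le_one (p : Torus 2) : S.du p 0 ≤ 1 := by
  have h := PiLp.norm_apply_le (S.du p) 0
  rw [S.norm_du] at h
  exact (le_abs_self _).trans h

theorem le_shear (p : Cover 3) : S.c * S.β ≤ S.shear p :=
  mul_le_mul (S.c_le _) (S.β_le _) S.β_pos.le (S.r.deriv_pos _).le

theorem shear_pos (p : Cover 3) : 0 < S.shear p := (mul_pos S.c_pos S.β_pos).trans_le (S.le_shear p)

theorem shear_le (p : Cover 3) : S.shear p ≤ S.C := by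
  have h := mul_le_mul (S.le_C (p 0 : ℝ)) (S.du_zero_le_one (proj (horizontal p)))
    (S.β_pos.le.trans (S.β_le _)) S.C_pos.le
  rwa [mul_one] at h

theorem slope_term_nonneg (p : Cover 3) (k : ℕ) :
    0 ≤ (∏ i ∈ Finset.range (k + 1), S.slopeFactor (S.F.lift.symm^[i + 1] p)) *
      S.shear (S.F.lift.symm^[k + 1] p) :=
  mul_nonneg (Finset.prod_nonneg fun _ _ => (S.slopeFactor_pos _).le) (S.shear_pos _).le

theorem slope_term_le (p : Cover 3) (k : ℕ) :
    (∏ i ∈ Finset.range (k + 1), S.slopeFactor (S.F.lift.symm^[i + 1] p)) *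
      S.shear (S.F.lift.symm^[k + 1] p) ≤ S.C * S.domination * S.domination ^ k := by
  have h : ∏ i ∈ Finset.range (k + 1), S.slopeFactor (S.F.lift.symm^[i + 1] p)
      ≤ S.domination ^ (k + 1) := by
    refine (Finset.prod_le_prod (fun _ _ => (S.slopeFactor_pos _).le)
      fun _ _ => S.slopeFactor_le _).trans ?_
    simp
  have h2 := mul_le_mul h (S.shear_le (S.F.lift.symm^[k + 1] p)) (S.shear_pos _).le
    (pow_nonneg S.domination_pos.le _)
  rw [pow_succ] at h2
  linarith

theorem summable_slope (p : Cover 3) : Summable fun k : ℕ =>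
    (∏ i ∈ Finset.range (k + 1), S.slopeFactor (S.F.lift.symm^[i + 1] p)) *
      S.shear (S.F.lift.symm^[k + 1] p) :=
  Summable.of_nonneg_of_le (S.slope_term_nonneg p) (S.slope_term_le p)
    ((summable_geometric_of_lt_one S.domination_pos.le S.domination_lt_one).mul_left _)

theorem slope_nonneg (p : Cover 3) : 0 ≤ S.slope p := tsum_nonneg (S.slope_term_nonneg p)

theorem slope_le (p : Cover 3) : S.slope p ≤ S.C * (S.lamMax / (S.αuMin - S.lamMax)) := by
  have hg := summable_geometric_of_lt_one S.domination_pos.le S.domination_lt_one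
  refine ((S.summable_slope p).tsum_le_tsum (S.slope_term_le p) (hg.mul_left _)).trans_eq ?_
  rw [tsum_mul_left, tsum_geometric_of_lt_one S.domination_pos.le S.domination_lt_one, domination]
  have h1 := S.αuMin_pos.ne'
  have h2 : S.αuMin - S.lamMax ≠ 0 := (sub_pos.2 S.lamMax_lt_αuMin).ne'
  field_simp

/-- The slope is invariant under the action of `F` on lines. -/
theorem slope_F (p : Cover 3) :
    S.slope (S.F.lift p) = S.slopeFactor p * (S.slope p + S.shear p) := by
  have hshift : ∀ i, S.F.lift.symm^[i + 1] (S.F.lift p) = S.F.lift.symm^[i] p := fun i => by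
    rw [Function.iterate_succ_apply, Equiv.symm_apply_apply]
  have hs := S.summable_slope (S.F.lift p)
  unfold slope
  rw [hs.tsum_eq_zero_add]
  simp only [hshift]
  have h : ∀ k, (∏ i ∈ Finset.range (k + 1 + 1), S.slopeFactor (S.F.lift.symm^[i] p)) *
      S.shear (S.F.lift.symm^[k + 1] p) = S.slopeFactor p *
      ((∏ i ∈ Finset.range (k + 1), S.slopeFactor (S.F.lift.symm^[i + 1] p)) *
      S.shear (S.F.lift.symm^[k + 1] p)) := fun k => by
    rw [Finset.prod_range_succ']
    simp only [Function.iterate_zero, id]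
    ring
  simp only [h, tsum_mul_left]
  simp
  ring

theorem slope_pos (p : Cover 3) : 0 < S.slope p := by
  obtain ⟨q, rfl⟩ := S.F.lift.surjective p
  rw [S.slope_F]
  exact mul_pos (S.slopeFactor_pos q) (add_pos_of_nonneg_of_pos (S.slope_nonneg q) (S.shear_pos q))

/-- The vector `(∂_A^u, h)` that spans the strong unstable line of `F`. -/
def duF (p : Cover 3) : Cover 3 :=
  !₂[S.du (proj (horizontal p)) 0, S.du (proj (horizontal p)) 1, S.slope p]

theorem horizontal_duF (p : Cover 3) : horizontal (S.duF p) = S.du (proj (horizontal p)) := by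
  ext i; fin_cases i <;> rfl

theorem duF_zero (p : Cover 3) : S.duF p 0 = S.du (proj (horizontal p)) 0 := rfl

theorem duF_two (p : Cover 3) : S.duF p 2 = S.slope p := rfl

theorem norm_sq_duF (p : Cover 3) : ‖S.duF p‖ ^ 2 = 1 + S.slope p ^ 2 := by
  rw [norm_sq_eq_horizontal, S.horizontal_duF, S.norm_du, S.duF_two, one_pow]

theorem one_le_norm_duF (p : Cover 3) : 1 ≤ ‖S.duF p‖ := by
  refine le_of_sq_le_sq ?_ (norm_nonneg _)
  rw [norm_sq_duF]
  nlinarith [sq_nonneg (S.slope p)]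

theorem norm_duF_pos (p : Cover 3) : 0 < ‖S.duF p‖ := one_pos.trans_le (S.one_le_norm_duF p)

theorem norm_duF_le (p : Cover 3) :
    ‖S.duF p‖ ≤ 1 + S.C * (S.lamMax / (S.αuMin - S.lamMax)) := by
  have h0 := S.slope_nonneg p
  have h1 := S.slope_le p
  refine le_trans (le_of_sq_le_sq (b := 1 + S.slope p) ?_ (by linarith)) (by linarith)
  rw [norm_sq_duF]
  nlinarith

theorem duF_ne_zero (p : Cover 3) : S.duF p ≠ 0 := norm_pos_iff.1 (S.norm_duF_pos p)

theorem map_duF (p : Cover 3) : fderiv ℝ S.F.lift p (S.duF p)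
    = S.αu (proj (horizontal p)) • S.duF (S.F.lift p) := by
  apply ext_horizontal
  · rw [S.horizontal_fderiv, S.horizontal_duF, S.map_du', horizontal_smul, S.horizontal_duF,
      S.horizontal_F_lift]
  · rw [S.fderiv_F_two, PiLp.smul_apply, S.duF_two, S.duF_two, S.slope_F, slopeFactor, shear,
      S.duF_zero, smul_eq_mul]
    have := (S.αu_pos (proj (horizontal p))).ne'
    field_simp

theorem map_vertical (p : Cover 3) : fderiv ℝ S.F.lift p (EuclideanSpace.single 2 1)
    = S.g.deriv (S.phase p : ℝ) • (EuclideanSpace.single 2 1 : Cover 3) := by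
  apply ext_horizontal
  · rw [S.horizontal_fderiv, horizontal_smul]
    have : horizontal (EuclideanSpace.single 2 1) = 0 := by
      ext i; fin_cases i <;> simp [horizontal]
    rw [this, map_zero, smul_zero]
  · rw [S.fderiv_F_two]
    simp

theorem fderiv_iterate_symm_duF (k : ℕ) (p : Cover 3) :
    fderiv ℝ (S.F.lift.symm^[k]) p (S.duF p)
      = (∏ i ∈ Finset.Icc 1 k, S.αu (proj (S.A.lift.symm^[i] (horizontal p))))⁻¹ •
        S.duF (S.F.lift.symm^[k] p) := by
  rw [TorusDiffeo.fderiv_iterate_symm_of_invariant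
    (m := fun p => S.αu (proj (horizontal p))) (fun _ => (S.αu_pos _).ne') S.map_duF]
  simp only [S.horizontal_iterate]

theorem prod_inv_αu_le (k : ℕ) (x : Cover 2) :
    (∏ i ∈ Finset.Icc 1 k, S.αu (proj (S.A.lift.symm^[i] x)))⁻¹ ≤ S.lam ^ k := by
  rw [← Finset.prod_inv_distrib]
  refine (Finset.prod_le_prod (fun _ _ => (inv_pos.2 (S.αu_pos _)).le)
    fun _ _ => inv_le_of_inv_le₀ S.lam_pos (S.inv_lam_le_αu _)).trans ?_
  simp

theorem prod_inv_αu_pos (k : ℕ) (x : Cover 2) :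
    0 < (∏ i ∈ Finset.Icc 1 k, S.αu (proj (S.A.lift.symm^[i] x)))⁻¹ :=
  inv_pos.2 (Finset.prod_pos fun _ _ => S.αu_pos _)

/-- The strong unstable space of `F` is the line spanned by `(∂_A^u, h)`: a stable component in the
base would be expanded, and a vertical component contracted too slowly, by `F⁻ⁿ`. -/
theorem Euf_eq_span (p : Cover 3) : S.Euf p = Submodule.span ℝ {S.duF p} := by
  have hl0 := S.lam_pos
  have hl1 := S.lam_lt_one
  refine le_antisymm ?_ ?_
  · rintro v ⟨K, hK⟩
    obtain ⟨a, b, hab⟩ := S.exists_decomposition (proj (horizontal p)) (horizontal v)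
    have hb : b = 0 := by
      have hbound : ∀ k : ℕ, |b| ≤ (|K| + |a|) * (S.lam ^ k) := by
        intro k
        have h1 := (norm_horizontal_le _).trans (hK k)
        rw [S.horizontal_fderiv_iterate_symm, hab, map_add, map_smul, map_smul,
          TorusDiffeo.fderiv_iterate_symm_of_invariant (X := fun x => S.du (proj x))
            (m := fun x => S.αu (proj x)) (fun _ => (S.αu_pos _).ne') S.map_du',
          TorusDiffeo.fderiv_iterate_symm_of_invariant (X := fun x => S.ds (proj x))
            (m := fun x => S.αs (proj x)) (fun _ => (S.αs_pos _).ne') S.map_ds'] at h1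
        have h2 := norm_sub_le_norm_add
          (b • (∏ i ∈ Finset.Icc 1 k, S.αs (proj (S.A.lift.symm^[i] (horizontal p))))⁻¹ •
            S.ds (proj (S.A.lift.symm^[k] (horizontal p))))
          (a • (∏ i ∈ Finset.Icc 1 k, S.αu (proj (S.A.lift.symm^[i] (horizontal p))))⁻¹ •
            S.du (proj (S.A.lift.symm^[k] (horizontal p))))
        rw [add_comm] at h2
        have hs : 1 ≤ (∏ i ∈ Finset.Icc 1 k,
            S.αs (proj (S.A.lift.symm^[i] (horizontal p))))⁻¹ := by
          refine (one_le_inv₀ (Finset.prod_pos fun _ _ => S.αs_pos _)).2 ?_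
          exact Finset.prod_le_one (fun _ _ => (S.αs_pos _).le)
            fun _ _ => (S.αs_le _).trans hl1.le
        have hu := S.prod_inv_αu_le k (horizontal p)
        have hu0 := S.prod_inv_αu_pos k (horizontal p)
        simp only [norm_smul, S.norm_du, S.norm_ds, mul_one, Real.norm_eq_abs] at h2
        rw [abs_of_pos (one_pos.trans_le hs), abs_of_pos hu0] at h2
        have h3 := mul_le_mul_of_nonneg_left hs (abs_nonneg b)
        have h4 := mul_le_mul_of_nonneg_left hu (abs_nonneg a)
        have h5 := mul_le_mul_of_nonneg_right (le_abs_self K) (pow_nonneg hl0.le k)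
        linarith
      have hlim := (tendsto_pow_atTop_nhds_zero_of_lt_one hl0.le hl1).const_mul (|K| + |a|)
      rw [mul_zero] at hlim
      exact abs_eq_zero.1 (le_antisymm (ge_of_tendsto' hlim hbound) (abs_nonneg _))
    rw [hb, zero_smul, add_zero] at hab
    obtain ⟨w, hw⟩ : ∃ w, w = v 2 - a * S.slope p := ⟨_, rfl⟩
    have hv : v = a • S.duF p + w • EuclideanSpace.single 2 1 := by
      apply ext_horizontal
      · rw [hab]
        ext i; fin_cases i <;> simp [horizontal, duF]
      · simp [duF, hw]
    have hw0 : w = 0 := by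
      have hbound : ∀ k : ℕ, |w| ≤ (|K| + |a| * (1 + S.C * (S.lamMax / (S.αuMin - S.lamMax)))) *
          ((S.lam * S.lamMax) ^ k) := by
        intro k
        have h1 := hK k
        rw [hv, map_add, map_smul, map_smul, S.fderiv_iterate_symm_duF,
          TorusDiffeo.fderiv_iterate_symm_of_invariant
            (X := fun _ => EuclideanSpace.single 2 1)
            (m := fun x => S.g.deriv (S.phase x : ℝ)) (fun _ => (S.g.deriv_pos _).ne')
            S.map_vertical] at h1
        have h2 := norm_sub_le_norm_add
          (w • (∏ i ∈ Finset.Icc 1 k, S.g.deriv (S.phase (S.F.lift.symm^[i] p) : ℝ))⁻¹ •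
            (EuclideanSpace.single 2 1 : Cover 3))
          (a • (∏ i ∈ Finset.Icc 1 k, S.αu (proj (S.A.lift.symm^[i] (horizontal p))))⁻¹ •
            S.duF (S.F.lift.symm^[k] p))
        rw [add_comm] at h2
        have hP : 0 < ∏ i ∈ Finset.Icc 1 k, S.g.deriv (S.phase (S.F.lift.symm^[i] p) : ℝ) :=
          Finset.prod_pos fun _ _ => S.g.deriv_pos _
        have hP2 : ∏ i ∈ Finset.Icc 1 k, S.g.deriv (S.phase (S.F.lift.symm^[i] p) : ℝ)
            ≤ S.lamMax ^ k := by
          refine (Finset.prod_le_prod (fun _ _ => (S.g.deriv_pos _).le)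
            fun _ _ => S.deriv_g_le _).trans ?_
          simp
        have hu := S.prod_inv_αu_le k (horizontal p)
        have hu0 := S.prod_inv_αu_pos k (horizontal p)
        simp only [norm_smul, Real.norm_eq_abs, PiLp.norm_single, abs_one, mul_one] at h2
        rw [abs_of_pos (inv_pos.2 hP), abs_of_pos hu0] at h2
        have h4 : |a| * ((∏ i ∈ Finset.Icc 1 k,
            S.αu (proj (S.A.lift.symm^[i] (horizontal p))))⁻¹ * ‖S.duF (S.F.lift.symm^[k] p)‖)
            ≤ |a| * (S.lam ^ k * (1 + S.C * (S.lamMax / (S.αuMin - S.lamMax)))) := by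
          have := S.norm_duF_le (S.F.lift.symm^[k] p)
          gcongr
        have h5 := mul_le_mul_of_nonneg_right (le_abs_self K) (pow_nonneg hl0.le k)
        have h6 : |w| * (∏ i ∈ Finset.Icc 1 k,
            S.g.deriv (S.phase (S.F.lift.symm^[i] p) : ℝ))⁻¹ ≤
            (|K| + |a| * (1 + S.C * (S.lamMax / (S.αuMin - S.lamMax)))) * S.lam ^ k := by
          linarith
        rw [← div_eq_mul_inv, div_le_iff₀ hP] at h6
        refine h6.trans ?_
        rw [mul_pow, ← mul_assoc]
        refine mul_le_mul_of_nonneg_left hP2 ?_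
        have := (norm_nonneg (S.duF p)).trans (S.norm_duF_le p)
        positivity
      have hlt : S.lam * S.lamMax < 1 := by
        have h := mul_lt_mul_of_pos_left S.max_lt hl0
        rwa [mul_inv_cancel₀ hl0.ne'] at h
      have hlim := (tendsto_pow_atTop_nhds_zero_of_lt_one
        (mul_nonneg hl0.le S.lamMax_pos.le) hlt).const_mul
        (|K| + |a| * (1 + S.C * (S.lamMax / (S.αuMin - S.lamMax))))
      rw [mul_zero] at hlim
      exact abs_eq_zero.1 (le_antisymm (ge_of_tendsto' hlim hbound) (abs_nonneg _))
    rw [hw0, zero_smul, add_zero] at hv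
    exact Submodule.mem_span_singleton.2 ⟨a, hv.symm⟩
  · rw [Submodule.span_singleton_le_iff_mem]
    refine ⟨1 + S.C * (S.lamMax / (S.αuMin - S.lamMax)), fun k => ?_⟩
    rw [S.fderiv_iterate_symm_duF, norm_smul, Real.norm_eq_abs,
      abs_of_pos (S.prod_inv_αu_pos k _), mul_comm]
    exact mul_le_mul (S.norm_duF_le _) (S.prod_inv_αu_le k _) (S.prod_inv_αu_pos k _).le
      ((norm_nonneg _).trans (S.norm_duF_le p))

theorem dilation_unstable (p : Cover 3) : dilation S.F S.Euf p
    = S.αu (proj (horizontal p)) * ‖S.duF (S.F.lift p)‖ / ‖S.duF p‖ := by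
  rw [dilation_eq_of_span (S.Euf_eq_span p) (S.duF_ne_zero p) (S.map_duF p),
    abs_of_pos (S.αu_pos _)]

theorem dilation_center (p : Cover 3) :
    dilation S.F Ec p = S.g.deriv (S.phase p : ℝ) := by
  rw [dilation_eq_of_span (X := fun _ => EuclideanSpace.single 2 1) rfl (by simp)
    (S.map_vertical p), abs_of_pos (S.g.deriv_pos _)]
  simp

/-- The slopes at two points whose backward orbits approach each other at the rate `lam` become
equal along these orbits. -/
theorem tendsto_slope_sub {p q : Cover 3} {d : ℝ} (hd : 0 ≤ d)
    (hpq : ∀ i, ‖S.F.lift.symm^[i] p - S.F.lift.symm^[i] q‖ ≤ d * S.lam ^ i) :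
    Tendsto (fun k => S.slope (S.F.lift.symm^[k] p) - S.slope (S.F.lift.symm^[k] q)) atTop
      (𝓝 0) := by
  have hl0 := S.lam_pos
  have hl1 := S.lam_lt_one
  set P := fun k => S.F.lift.symm^[k] p with hP
  set Q := fun k => S.F.lift.symm^[k] q with hQ
  obtain ⟨c, hc, hreg⟩ := S.exists_regularity
  have hpow : ∀ a : ℝ, Tendsto (fun k : ℕ => a * S.lam ^ k) atTop (𝓝 0) := fun a => by
    simpa using (tendsto_pow_atTop_nhds_zero_of_lt_one hl0.le hl1).const_mul a
  have hhor : ∀ i, ‖S.A.lift.symm^[i] (horizontal p) - S.A.lift.symm^[i] (horizontal q)‖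
      ≤ d * S.lam ^ i := fun i => by
    rw [← S.horizontal_iterate, ← S.horizontal_iterate, ← horizontalL_apply, ← horizontalL_apply,
      ← map_sub]
    exact (norm_horizontal_le _).trans (hpq i)
  have hcoord : ∀ i : Fin 3, Tendsto (fun k => P k i - Q k i) atTop (𝓝 0) := fun i =>
    squeeze_zero_norm (fun k => (PiLp.norm_apply_le (P k - Q k) i).trans (hpq k)) (hpow d)
  have hαu : Tendsto (fun k => S.αu (proj (horizontal (P k))) - S.αu (proj (horizontal (Q k))))
      atTop (𝓝 0) := by
    refine squeeze_zero_norm (fun k => ?_) (hpow (c * d))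
    have := (hreg d _ _ hd hhor k).2
    rwa [← S.horizontal_iterate, ← S.horizontal_iterate, ← mul_assoc] at this
  have hdu : Tendsto (fun k => S.du (proj (horizontal (P k))) 0
      - S.du (proj (horizontal (Q k))) 0) atTop (𝓝 0) := by
    refine squeeze_zero_norm (fun k => ?_) (hpow (c * d))
    have := (hreg d _ _ hd hhor k).1
    rw [← S.horizontal_iterate, ← S.horizontal_iterate, ← mul_assoc] at this
    exact (PiLp.norm_apply_le (S.du (proj (horizontal (P k)))
      - S.du (proj (horizontal (Q k)))) 0).trans this
  have hrl : ∀ x y : ℝ, |S.r.lift x - S.r.lift y| ≤ S.C * |x - y| := fun x y =>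
    convex_univ.norm_image_sub_le_of_norm_deriv_le (fun z _ => S.r.differentiable_lift z)
      (fun z _ => by
        rw [← S.r.deriv_coe, Real.norm_eq_abs, abs_of_pos (S.r.deriv_pos _)]
        exact S.le_C _) (mem_univ y) (mem_univ x)
  have hphase : Tendsto (fun k => S.phase (P k) - S.phase (Q k)) atTop (𝓝 0) := by
    have h1 : Tendsto (fun k => S.r.lift (P k 0) - S.r.lift (Q k 0)) atTop (𝓝 0) :=
      squeeze_zero_norm (fun k => hrl _ _) (by simpa using (hcoord 0).abs.const_mul S.C)
    have h2 := (hcoord 2).add h1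
    rw [add_zero] at h2
    refine h2.congr fun k => ?_
    simp only [phase]
    ring
  obtain ⟨Lg, -, hLg⟩ := S.g.exists_lipschitz_deriv
  obtain ⟨Lr, -, hLr⟩ := S.r.exists_lipschitz_deriv
  have hg : Tendsto (fun k => S.g.deriv (S.phase (P k) : ℝ) - S.g.deriv (S.phase (Q k) : ℝ)) atTop
      (𝓝 0) :=
    squeeze_zero_norm (fun k => hLg _ _) (by simpa using hphase.abs.const_mul Lg)
  have hr : Tendsto (fun k => S.r.deriv (P k 0 : ℝ) - S.r.deriv (Q k 0 : ℝ)) atTop (𝓝 0) :=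
    squeeze_zero_norm (fun k => hLr _ _) (by simpa using (hcoord 0).abs.const_mul Lr)
  have hfac : Tendsto (fun k => |S.slopeFactor (P k) - S.slopeFactor (Q k)|) atTop (𝓝 0) := by
    refine squeeze_zero (fun _ => abs_nonneg _) (fun k => ?_)
      (g := fun k => |S.g.deriv (S.phase (P k) : ℝ) - S.g.deriv (S.phase (Q k) : ℝ)|
        + S.lamMax * |S.αu (proj (horizontal (P k))) - S.αu (proj (horizontal (Q k)))|)
      (by simpa using hg.abs.add (hαu.abs.const_mul S.lamMax))
    unfold slopeFactor
    set a := S.αu (proj (horizontal (P k)))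
    set b := S.αu (proj (horizontal (Q k)))
    set u := S.g.deriv (S.phase (P k) : ℝ)
    set v := S.g.deriv (S.phase (Q k) : ℝ)
    have ha : 1 < a := S.one_lt_αu _
    have hb : 1 < b := S.one_lt_αu _
    have hv0 : 0 < v := S.g.deriv_pos _
    have hv : v ≤ S.lamMax := S.deriv_g_le _
    have heq : u / a - v / b = (u - v) / a + v * (b - a) / (a * b) := by
      field_simp; ring
    rw [heq]
    refine (abs_add_le _ _).trans (add_le_add ?_ ?_)
    · rw [abs_div, abs_of_pos (one_pos.trans ha)]
      exact div_le_self (abs_nonneg _) ha.le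
    · rw [abs_div, abs_mul, abs_of_pos hv0, abs_of_pos (by positivity : 0 < a * b), abs_sub_comm]
      refine (div_le_self (by positivity) (by nlinarith)).trans ?_
      gcongr
  have hsh : Tendsto (fun k => |S.shear (P k) - S.shear (Q k)|) atTop (𝓝 0) := by
    refine squeeze_zero (fun _ => abs_nonneg _) (fun k => ?_)
      (g := fun k => |S.r.deriv (P k 0 : ℝ) - S.r.deriv (Q k 0 : ℝ)|
        + S.C * |S.du (proj (horizontal (P k))) 0 - S.du (proj (horizontal (Q k))) 0|)
      (by simpa using hr.abs.add (hdu.abs.const_mul S.C))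
    unfold shear
    set a := S.r.deriv (P k 0 : ℝ)
    set b := S.r.deriv (Q k 0 : ℝ)
    set u := S.du (proj (horizontal (P k))) 0
    set v := S.du (proj (horizontal (Q k))) 0
    have hb0 : 0 < b := S.r.deriv_pos _
    have hb : b ≤ S.C := S.le_C _
    have hu0 : 0 < u := S.β_pos.trans_le (S.β_le _)
    have hu : u ≤ 1 := S.du_zero_le_one _
    have heq : a * u - b * v = (a - b) * u + b * (u - v) := by ring
    rw [heq]
    refine (abs_add_le _ _).trans (add_le_add ?_ ?_)
    · rw [abs_mul, abs_of_pos hu0]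
      exact mul_le_of_le_one_right (abs_nonneg _) hu
    · rw [abs_mul, abs_of_pos hb0]
      gcongr
  set H := S.C * (S.lamMax / (S.αuMin - S.lamMax)) with hH
  have hstep : ∀ k, P k = S.F.lift (P (k + 1)) := fun k => by
    simp only [hP, Function.iterate_succ_apply', Equiv.apply_symm_apply]
  have hstep' : ∀ k, Q k = S.F.lift (Q (k + 1)) := fun k => by
    simp only [hQ, Function.iterate_succ_apply', Equiv.apply_symm_apply]
  rw [tendsto_zero_iff_abs_tendsto_zero]
  refine tendsto_zero_of_le_mul_succ_add (θ := S.domination) (B := H)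
    (ε := fun k => S.domination * |S.shear (P (k + 1)) - S.shear (Q (k + 1))|
      + (H + S.C) * |S.slopeFactor (P (k + 1)) - S.slopeFactor (Q (k + 1))|)
    S.domination_pos.le S.domination_lt_one (fun _ => abs_nonneg _) (fun k => ?_) ?_ (fun k => ?_)
  · change |S.slope (P k) - S.slope (Q k)| ≤
      S.domination * |S.slope (P (k + 1)) - S.slope (Q (k + 1))| + _
    rw [hstep k, hstep' k, S.slope_F, S.slope_F]
    set a := S.slopeFactor (P (k + 1))
    set b := S.slopeFactor (Q (k + 1))
    set s := S.slope (P (k + 1))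
    set t := S.slope (Q (k + 1))
    set u := S.shear (P (k + 1))
    set v := S.shear (Q (k + 1))
    have ha0 : 0 < a := S.slopeFactor_pos _
    have ha : a ≤ S.domination := S.slopeFactor_le _
    have ht0 : 0 ≤ t := S.slope_nonneg _
    have ht : t ≤ H := S.slope_le _
    have hv0 : 0 < v := S.shear_pos _
    have hv : v ≤ S.C := S.shear_le _
    have heq : a * (s + u) - b * (t + v) = a * (s - t) + a * (u - v) + (t + v) * (a - b) := by
      ring
    rw [heq]
    refine (abs_add_three _ _ _).trans ?_
    rw [abs_mul, abs_mul, abs_mul, abs_of_pos ha0, abs_of_nonneg (by linarith : 0 ≤ t + v),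
      add_assoc]
    gcongr
  · have h1 := ((hsh.comp (tendsto_add_atTop_nat 1)).const_mul S.domination).add
      ((hfac.comp (tendsto_add_atTop_nat 1)).const_mul (H + S.C))
    simpa using h1
  · have h1 := S.slope_nonneg (P k)
    have h2 := S.slope_nonneg (Q k)
    have h3 := S.slope_le (P k)
    have h4 := S.slope_le (Q k)
    exact abs_sub_le_iff.2 ⟨by linarith, by linarith⟩


/-! ### Reference densities on unstable curves -/

/-- `∑ i ≥ 1, log α^u(A⁻ⁱx₀) - log α^u(A⁻ⁱx)`, the logarithm of the ratio `ρ(x) / ρ(x₀)` of the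
reference density of `A` at two points of an unstable segment. -/
def logDensity (x₀ x : Cover 2) : ℝ :=
  ∑' i : ℕ, (Real.log (S.αu (proj (S.A.lift.symm^[i + 1] x₀)))
    - Real.log (S.αu (proj (S.A.lift.symm^[i + 1] x))))

/-- The backward orbits of `x` and `y` under `A` approach each other at the rate `lam`. -/
def BackwardAsymptotic (d : ℝ) (x y : Cover 2) : Prop :=
  ∀ i, ‖S.A.lift.symm^[i] x - S.A.lift.symm^[i] y‖ ≤ d * S.lam ^ i

theorem exists_summable_logDensity : ∃ c, 0 < c ∧ ∀ (d : ℝ) (x y : Cover 2), 0 ≤ d →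
    S.BackwardAsymptotic d x y →
    (Summable fun i : ℕ => Real.log (S.αu (proj (S.A.lift.symm^[i + 1] x)))
      - Real.log (S.αu (proj (S.A.lift.symm^[i + 1] y)))) ∧ |S.logDensity x y| ≤ c * d := by
  obtain ⟨c, hc, hreg⟩ := S.exists_regularity
  have hl0 := S.lam_pos
  have hl1 := S.lam_lt_one
  have h1l : 0 < 1 - S.lam := by linarith
  have hg := summable_geometric_of_lt_one hl0.le hl1
  refine ⟨c / (1 - S.lam), by positivity, fun d x y hd hxy => ?_⟩
  have hterm : ∀ i : ℕ, ‖Real.log (S.αu (proj (S.A.lift.symm^[i + 1] x)))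
      - Real.log (S.αu (proj (S.A.lift.symm^[i + 1] y)))‖ ≤ c * d * S.lam ^ i := fun i => by
    refine (abs_log_sub_log_le_of_one_le (S.one_lt_αu _).le (S.one_lt_αu _).le).trans
      ((hreg d x y hd hxy (i + 1)).2.trans ?_)
    rw [mul_assoc]
    gcongr c * (d * ?_)
    exact pow_le_pow_of_le_one hl0.le hl1.le (Nat.le_succ i)
  refine ⟨Summable.of_norm_bounded (hg.mul_left _) hterm, ?_⟩
  have h := tsum_of_norm_bounded (hg.mul_left (c * d)).hasSum hterm
  rw [tsum_mul_left, tsum_geometric_of_lt_one hl0.le hl1] at h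
  refine h.trans_eq ?_
  ring

theorem logDensity_sub {d₁ d₂ : ℝ} (hd₁ : 0 ≤ d₁) (hd₂ : 0 ≤ d₂) {x₀ x y : Cover 2}
    (hx : S.BackwardAsymptotic d₁ x₀ x) (hy : S.BackwardAsymptotic d₂ x₀ y) :
    S.logDensity x₀ x - S.logDensity x₀ y = S.logDensity y x := by
  obtain ⟨c, -, hsum⟩ := S.exists_summable_logDensity
  unfold logDensity
  rw [← (hsum d₁ _ _ hd₁ hx).1.tsum_sub (hsum d₂ _ _ hd₂ hy).1]
  congr 1
  ext i
  ring

theorem tendsto_prod_αu_div {d : ℝ} (hd : 0 ≤ d) {x y : Cover 2}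
    (hxy : S.BackwardAsymptotic d x y) :
    Tendsto (fun k : ℕ => ∏ i ∈ Finset.Icc 1 k,
      S.αu (proj (S.A.lift.symm^[i] x)) / S.αu (proj (S.A.lift.symm^[i] y))) atTop
      (𝓝 (Real.exp (S.logDensity x y))) := by
  obtain ⟨c, -, hsum⟩ := S.exists_summable_logDensity
  have h := (Real.continuous_exp.tendsto _).comp (hsum d _ _ hd hxy).1.hasSum.tendsto_sum_nat
  refine h.congr fun k => ?_
  have hshift : ∀ f : ℕ → ℝ, ∏ i ∈ Finset.Icc 1 k, f i = ∏ i ∈ Finset.range k, f (i + 1) := by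
    intro f
    induction k with
    | zero => simp
    | succ k ih => rw [Finset.prod_Icc_succ_top (by omega), ih, Finset.prod_range_succ]
  rw [Function.comp_apply, Real.exp_sum, hshift]
  refine Finset.prod_congr rfl fun i _ => ?_
  rw [Real.exp_sub, Real.exp_log (S.αu_pos _), Real.exp_log (S.αu_pos _)]

/-- Backward iterates of an unstable curve of `F` are contracted at the rate `lam`. -/
theorem norm_iterate_symm_sub_le {η : ℝ → Cover 3} {b : ℝ → ℝ}
    (hη : ∀ t, HasDerivAt η (b t • S.duF (η t)) t) {I : Set ℝ} (hI : Convex ℝ I) {B : ℝ}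
    (hB : ∀ t ∈ I, |b t| ≤ B) {t t' : ℝ} (ht : t ∈ I) (ht' : t' ∈ I) (i : ℕ) :
    ‖S.F.lift.symm^[i] (η t) - S.F.lift.symm^[i] (η t')‖
      ≤ (B * (1 + S.C * (S.lamMax / (S.αuMin - S.lamMax))) * |t - t'|) * S.lam ^ i := by
  set H := 1 + S.C * (S.lamMax / (S.αuMin - S.lamMax)) with hH
  have hd : ∀ u ∈ I, HasDerivWithinAt (S.F.lift.symm^[i] ∘ η)
      (fderiv ℝ (S.F.lift.symm^[i]) (η u) (b u • S.duF (η u))) I u := fun u _ =>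
    ((S.F.differentiable_iterate_symm i (η u)).hasFDerivAt.comp_hasDerivAt u
      (hη u)).hasDerivWithinAt
  have h := hI.norm_image_sub_le_of_norm_hasDerivWithin_le hd (C := B * (S.lam ^ i * H))
    (fun u hu => by
      rw [map_smul, S.fderiv_iterate_symm_duF, norm_smul, norm_smul, Real.norm_eq_abs,
        Real.norm_eq_abs, abs_of_pos (S.prod_inv_αu_pos _ _)]
      have h1 := S.prod_inv_αu_le i (horizontal (η u))
      have h2 := S.norm_duF_le (S.F.lift.symm^[i] (η u))
      have h3 := hB u hu
      have h4 := (abs_nonneg _).trans h3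
      have h5 := S.lam_pos
      have h6 := S.prod_inv_αu_pos i (horizontal (η u))
      gcongr) ht' ht
  refine h.trans_eq ?_
  rw [Real.norm_eq_abs]
  ring

theorem backwardAsymptotic_of_curve {η : ℝ → Cover 3} {b : ℝ → ℝ}
    (hη : ∀ t, HasDerivAt η (b t • S.duF (η t)) t) {I : Set ℝ} (hI : Convex ℝ I) {B : ℝ}
    (hB : ∀ t ∈ I, |b t| ≤ B) {t t' : ℝ} (ht : t ∈ I) (ht' : t' ∈ I) :
    S.BackwardAsymptotic (B * (1 + S.C * (S.lamMax / (S.αuMin - S.lamMax))) * |t - t'|)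
      (horizontal (η t)) (horizontal (η t')) := fun i => by
  rw [← S.horizontal_iterate, ← S.horizontal_iterate, ← horizontalL_apply, ← horizontalL_apply,
    ← map_sub]
  exact (norm_horizontal_le _).trans (S.norm_iterate_symm_sub_le hη hI hB ht ht' i)

theorem hasDerivAt_horizontal {η : ℝ → Cover 3} {b : ℝ → ℝ}
    (hη : ∀ t, HasDerivAt η (b t • S.duF (η t)) t) (t : ℝ) :
    HasDerivAt (horizontal ∘ η) (b t • S.du (proj (horizontal (η t)))) t := by
  have h := horizontalL.hasFDerivAt.comp_hasDerivAt t (hη t)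
  rwa [map_smul, horizontalL_apply, S.horizontal_duF] at h

theorem norm_deriv_horizontal {η : ℝ → Cover 3} {b : ℝ → ℝ}
    (hη : ∀ t, HasDerivAt η (b t • S.duF (η t)) t) (t : ℝ) :
    ‖deriv (horizontal ∘ η) t‖ = |b t| := by
  rw [(S.hasDerivAt_horizontal hη t).deriv, norm_smul, S.norm_du, mul_one, Real.norm_eq_abs]

/-- The product of the dilations of `F` along the backward orbit telescopes to the one of `A`. -/
theorem prod_dilation_div (p q : Cover 3) (k : ℕ) :
    ∏ i ∈ Finset.Icc 1 k, dilation S.F S.Euf (S.F.lift.symm^[i] q)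
      / dilation S.F S.Euf (S.F.lift.symm^[i] p)
    = (∏ i ∈ Finset.Icc 1 k, S.αu (proj (S.A.lift.symm^[i] (horizontal q)))
      / S.αu (proj (S.A.lift.symm^[i] (horizontal p)))) * (‖S.duF q‖ / ‖S.duF p‖)
      * (‖S.duF (S.F.lift.symm^[k] p)‖ / ‖S.duF (S.F.lift.symm^[k] q)‖) := by
  induction k with
  | zero =>
    have h1 := (S.norm_duF_pos p).ne'
    have h2 := (S.norm_duF_pos q).ne'
    simp
    field_simp
  | succ k ih =>
    rw [Finset.prod_Icc_succ_top (by omega), Finset.prod_Icc_succ_top (by omega), ih,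
      S.dilation_unstable, S.dilation_unstable, Function.iterate_succ_apply',
      Function.iterate_succ_apply', Equiv.apply_symm_apply, Equiv.apply_symm_apply,
      Function.iterate_succ_apply', Function.iterate_succ_apply', S.horizontal_F_lift_symm,
      S.horizontal_F_lift_symm, S.horizontal_iterate, S.horizontal_iterate]
    have h1 := (S.norm_duF_pos (S.F.lift.symm^[k] p)).ne'
    have h2 := (S.norm_duF_pos (S.F.lift.symm^[k] q)).ne'
    have h3 := (S.norm_duF_pos (S.F.lift.symm (S.F.lift.symm^[k] p))).ne'
    have h4 := (S.norm_duF_pos (S.F.lift.symm (S.F.lift.symm^[k] q))).ne'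
    have h5 := (S.norm_duF_pos p).ne'
    have h6 := (S.αu_pos (proj (S.A.lift.symm (S.A.lift.symm^[k] (horizontal p))))).ne'
    field_simp

theorem abs_norm_duF_sub_le (p q : Cover 3) :
    |‖S.duF p‖ - ‖S.duF q‖| ≤ |S.slope p - S.slope q| := by
  have h1 := S.norm_sq_duF p
  have h2 := S.norm_sq_duF q
  have h3 := S.slope_nonneg p
  have h4 := S.slope_nonneg q
  have hp : S.slope p ≤ ‖S.duF p‖ := le_of_sq_le_sq (by linarith) (norm_nonneg _)
  have hq : S.slope q ≤ ‖S.duF q‖ := le_of_sq_le_sq (by linarith) (norm_nonneg _)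
  have hpos : 0 < ‖S.duF p‖ + ‖S.duF q‖ := add_pos (S.norm_duF_pos p) (S.norm_duF_pos q)
  have heq : (‖S.duF p‖ - ‖S.duF q‖) * (‖S.duF p‖ + ‖S.duF q‖)
      = (S.slope p - S.slope q) * (S.slope p + S.slope q) := by
    linear_combination h1 - h2
  have h5 := congrArg abs heq
  rw [abs_mul, abs_mul, abs_of_pos hpos, abs_of_nonneg (add_nonneg h3 h4)] at h5
  have h6 : |S.slope p - S.slope q| * (S.slope p + S.slope q)
      ≤ |S.slope p - S.slope q| * (‖S.duF p‖ + ‖S.duF q‖) := by gcongr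
  rw [← h5] at h6
  exact le_of_mul_le_mul_right h6 hpos

theorem tendsto_norm_duF_div {p q : Cover 3} {d : ℝ} (hd : 0 ≤ d)
    (hpq : ∀ i, ‖S.F.lift.symm^[i] p - S.F.lift.symm^[i] q‖ ≤ d * S.lam ^ i) :
    Tendsto (fun k => ‖S.duF (S.F.lift.symm^[k] p)‖ / ‖S.duF (S.F.lift.symm^[k] q)‖) atTop
      (𝓝 1) := by
  have h := S.tendsto_slope_sub hd hpq
  have h2 : Tendsto (fun k => ‖S.duF (S.F.lift.symm^[k] p)‖ / ‖S.duF (S.F.lift.symm^[k] q)‖ - 1)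
      atTop (𝓝 0) := by
    refine squeeze_zero_norm (fun k => ?_) ((tendsto_zero_iff_abs_tendsto_zero _).1 h)
    have hq := S.norm_duF_pos (S.F.lift.symm^[k] q)
    rw [Real.norm_eq_abs, div_sub_one hq.ne', abs_div, abs_of_pos hq]
    exact (div_le_self (abs_nonneg _) (S.one_le_norm_duF _)).trans (S.abs_norm_duF_sub_le _ _)
  simpa using h2.add_const 1

/-- Reference densities exist on bounded pieces of unstable curves. The one of `F` is the one of
`A` on the projected curve, divided by the ratio of the arclength elements. -/
theorem exists_isReferenceDensity {η : ℝ → Cover 3} {b : ℝ → ℝ}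
    (hη : ∀ t, HasDerivAt η (b t • S.duF (η t)) t) (hb : ∀ t, b t ≠ 0) (hbc : Continuous fun t => |b t|)
    {J : Set ℝ} (hJb : Bornology.IsBounded J) (hJ : 0 < volume J) :
    ∃ ρ : Cover 2 → ℝ,
      IsReferenceDensity S.A (fun x => S.Eu (proj x)) (horizontal ∘ η) J ρ ∧
      IsReferenceDensity S.F S.Euf η J (fun p => ρ (horizontal p) / ‖S.duF p‖) := by
  obtain ⟨R, hR⟩ := hJb.subset_closedBall 0
  rw [Real.closedBall_eq_Icc] at hR
  set I := Icc (0 - R) (0 + R) with hI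
  have hIc : Convex ℝ I := convex_Icc _ _
  obtain ⟨B, hB⟩ := (isCompact_Icc (a := 0 - R) (b := 0 + R)).exists_bound_of_continuousOn
    hbc.continuousOn
  simp only [Real.norm_eq_abs, abs_abs] at hB
  obtain ⟨t₀, ht₀⟩ : J.Nonempty := nonempty_of_measure_ne_zero hJ.ne'
  have hB0 : 0 ≤ B := (abs_nonneg _).trans (hB t₀ (hR ht₀))
  set H := 1 + S.C * (S.lamMax / (S.αuMin - S.lamMax)) with hH
  have hH0 : 0 ≤ H := (norm_nonneg _).trans (S.norm_duF_le (η t₀))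
  have hasym : ∀ t ∈ I, ∀ t' ∈ I, S.BackwardAsymptotic (B * H * |t - t'|)
      (horizontal (η t)) (horizontal (η t')) := fun t ht t' ht' =>
    S.backwardAsymptotic_of_curve hη hIc hB ht ht'
  have hd0 : ∀ t t' : ℝ, 0 ≤ B * H * |t - t'| := fun t t' => by positivity
  obtain ⟨c, hc, hsum⟩ := S.exists_summable_logDensity
  set D : ℝ → ℝ := fun t => S.logDensity (horizontal (η t₀)) (horizontal (η t)) with hD
  have hDsub : ∀ t ∈ I, ∀ t' ∈ I,
      D t - D t' = S.logDensity (horizontal (η t')) (horizontal (η t)) := fun t ht t' ht' =>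
    S.logDensity_sub (hd0 t₀ t) (hd0 t₀ t') (hasym _ (hR ht₀) _ ht) (hasym _ (hR ht₀) _ ht')
  have hDc : ContinuousOn D I := by
    have hL : LipschitzOnWith (Real.toNNReal (c * (B * H))) D I := by
      refine LipschitzOnWith.of_dist_le_mul fun t ht t' ht' => ?_
      rw [Real.dist_eq, Real.dist_eq, hDsub t ht t' ht', Real.coe_toNNReal _ (by positivity),
        abs_sub_comm, mul_assoc]
      exact (hsum _ _ _ (hd0 t' t) (hasym t' ht' t ht)).2
    exact hL.continuousOn
  have hwc : ContinuousOn (fun t => Real.exp (D t) * |b t|) I :=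
    (Real.continuous_exp.comp_continuousOn hDc).mul hbc.continuousOn
  have hwi : IntegrableOn (fun t => Real.exp (D t) * |b t|) J :=
    (hwc.integrableOn_compact isCompact_Icc).mono_set hR
  have hN : 0 < ∫ t in J, Real.exp (D t) * |b t| := by
    rw [setIntegral_pos_iff_support_of_nonneg_ae (ae_of_all _ fun t => by positivity) hwi]
    have : Function.support (fun t => Real.exp (D t) * |b t|) = univ := by
      ext t
      simpa using hb t
    rwa [this, univ_inter]
  set N := ∫ t in J, Real.exp (D t) * |b t|
  have hint : ∫ t in J, Real.exp (D t) / N * |b t| = 1 := by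
    have : (fun t => Real.exp (D t) / N * |b t|) = fun t => N⁻¹ * (Real.exp (D t) * |b t|) := by
      funext t; ring
    rw [this, integral_const_mul, inv_mul_cancel₀ hN.ne']
  have hratio : ∀ t ∈ J, ∀ t' ∈ J, Tendsto (fun k : ℕ => ∏ i ∈ Finset.Icc 1 k,
      S.αu (proj (S.A.lift.symm^[i] (horizontal (η t'))))
        / S.αu (proj (S.A.lift.symm^[i] (horizontal (η t))))) atTop
      (𝓝 (Real.exp (D t) / N / (Real.exp (D t') / N))) := by
    intro t ht t' ht'
    rw [div_div_div_cancel_right₀ hN.ne', ← Real.exp_sub, hDsub t (hR ht) t' (hR ht')]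
    exact S.tendsto_prod_αu_div (hd0 _ _) (hasym t' (hR ht') t (hR ht))
  refine ⟨fun x => Real.exp (S.logDensity (horizontal (η t₀)) x) / N, ⟨?_, ?_, ?_⟩,
    ⟨?_, ?_, ?_⟩⟩
  · intro p _
    positivity
  · rintro _ ⟨t, ht, rfl⟩ _ ⟨t', ht', rfl⟩
    simp only [S.dilation_base]
    exact hratio t ht t' ht'
  · unfold arcIntegral
    simp only [S.norm_deriv_horizontal hη]
    exact hint
  · intro p _
    have := S.norm_duF_pos p
    positivity
  · rintro _ ⟨t, ht, rfl⟩ _ ⟨t', ht', rfl⟩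
    simp only [S.prod_dilation_div]
    have h1 := (hratio t ht t' ht').mul_const (‖S.duF (η t')‖ / ‖S.duF (η t)‖)
    have h2 := S.tendsto_norm_duF_div (hd0 t t')
      (S.norm_iterate_symm_sub_le hη hIc hB (hR ht) (hR ht'))
    have h3 := h1.mul h2
    convert h3 using 2
    have := (S.norm_duF_pos (η t)).ne'
    have := (S.norm_duF_pos (η t')).ne'
    field_simp
    exact mul_comm _ _
  · unfold arcIntegral
    refine Eq.trans ?_ hint
    congr 1
    funext t
    rw [(hη t).deriv, norm_smul, Real.norm_eq_abs]
    have := (S.norm_duF_pos (η t)).ne'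
    simp only [hD]
    field_simp

end CoupledSystem

/-! ### Integration over curves that cross the fiber circle once -/

/-- If an injective `C¹` function `s` on `J` meets every class modulo `1` exactly once, then
integrating a function on the circle along `s` amounts to integrating over the circle. -/
theorem setIntegral_abs_deriv_mul_comp {s s' : ℝ → ℝ} (hs : ∀ t, HasDerivAt s (s' t) t)
    {J : Set ℝ} (hJ : MeasurableSet J)
    (hbij : BijOn (fun t => (s t : UnitAddCircle)) J univ) (ψ : UnitAddCircle → ℝ) :
    ∫ t in J, |s' t| * ψ (s t : UnitAddCircle) = ∫ z, ψ z := by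
  have hinj : InjOn s J := fun t ht t' ht' h => hbij.injOn ht ht' (by simp only [h])
  have h1 := integral_image_eq_integral_abs_deriv_smul hJ
    (fun t _ => (hs t).hasDerivWithinAt) hinj (fun x : ℝ => ψ (x : UnitAddCircle))
  simp only [smul_eq_mul] at h1
  rw [← h1, ← UnitAddCircle.integral_preimage 0 ψ]
  have hc : Continuous s := continuous_iff_continuousAt.2 fun t => (hs t).continuousAt
  have hmeas : MeasurableSet (s '' J) := hJ.image_of_continuousOn_injOn hc.continuousOn hinj
  have hfd : IsAddFundamentalDomain (AddSubgroup.zmultiples (1 : ℝ)) (s '' J) volume := by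
    refine IsAddFundamentalDomain.mk' hmeas.nullMeasurableSet fun x => ?_
    obtain ⟨t, ht, hxt⟩ := hbij.surjOn (mem_univ (x : UnitAddCircle))
    have hmem : s t - x ∈ AddSubgroup.zmultiples (1 : ℝ) := by
      rw [← QuotientAddGroup.eq_zero_iff]
      change ((s t - x : ℝ) : UnitAddCircle) = 0
      rw [AddCircle.coe_sub, sub_eq_zero]
      exact hxt
    have hcoe : ∀ a : AddSubgroup.zmultiples (1 : ℝ),
        ((a +ᵥ x : ℝ) : UnitAddCircle) = (x : UnitAddCircle) := fun a => by
      have : ((a : ℝ) : UnitAddCircle) = 0 := (QuotientAddGroup.eq_zero_iff _).2 a.2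
      rw [AddSubgroup.vadd_def, vadd_eq_add, AddCircle.coe_add, this, zero_add]
    refine ⟨⟨s t - x, hmem⟩, ?_, ?_⟩
    · exact ⟨t, ht, by simp [AddSubgroup.vadd_def]⟩
    · rintro a ⟨u, hu, hua⟩
      have hut : u = t := hbij.injOn hu ht (by
        simp only [hua, hcoe a]
        exact hxt.symm)
      rw [hut, AddSubgroup.vadd_def, vadd_eq_add] at hua
      ext
      simp [hua]
  refine hfd.setIntegral_eq (isAddFundamentalDomain_Ioc one_pos 0 volume) fun a x => ?_
  have : ((a : ℝ) : UnitAddCircle) = 0 := (QuotientAddGroup.eq_zero_iff _).2 a.2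
  rw [AddSubgroup.vadd_def, vadd_eq_add, AddCircle.coe_add, this, zero_add]

namespace CircleDiffeo

variable (g : CircleDiffeo)

theorem continuous_log_deriv : Continuous fun z => Real.log (g.deriv z) :=
  g.continuous_deriv.log fun z => (g.deriv_pos z).ne'

theorem integrable_log_deriv : Integrable fun z => Real.log (g.deriv z) :=
  g.continuous_log_deriv.integrable_of_hasCompactSupport (HasCompactSupport.of_compactSpace _)

theorem measurableSet_expanding : MeasurableSet {z | 1 ≤ g.deriv z} :=
  (isClosed_le continuous_const g.continuous_deriv).measurableSet

theorem compl_expanding : {z | 1 ≤ g.deriv z}ᶜ = {z | g.deriv z < 1} := by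
  ext z; simp

open Classical in
/-- `log g'`, multiplied by `R` where it is nonnegative. -/
def weightedLog (R : ℝ) (z : UnitAddCircle) : ℝ :=
  {z | 1 ≤ g.deriv z}.piecewise (fun z => R * Real.log (g.deriv z))
    (fun z => Real.log (g.deriv z)) z

theorem weightedLog_of_le {R : ℝ} {z : UnitAddCircle} (h : 1 ≤ g.deriv z) :
    g.weightedLog R z = R * Real.log (g.deriv z) := piecewise_eq_of_mem _ _ _ h

theorem weightedLog_of_lt {R : ℝ} {z : UnitAddCircle} (h : g.deriv z < 1) :
    g.weightedLog R z = Real.log (g.deriv z) :=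
  piecewise_eq_of_notMem _ _ _ (by simpa using h)

theorem measurable_weightedLog (R : ℝ) : Measurable (g.weightedLog R) :=
  Measurable.piecewise g.measurableSet_expanding
    (g.continuous_log_deriv.measurable.const_mul R) g.continuous_log_deriv.measurable

theorem integral_weightedLog (R : ℝ) : ∫ z, g.weightedLog R z
    = R * (∫ z in {z | 1 ≤ g.deriv z}, Real.log (g.deriv z))
      + ∫ z in {z | g.deriv z < 1}, Real.log (g.deriv z) := by
  classical
  unfold weightedLog
  rw [integral_piecewise g.measurableSet_expanding (g.integrable_log_deriv.const_mul R).integrableOn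
    g.integrable_log_deriv.integrableOn, integral_const_mul, g.compl_expanding]

end CircleDiffeo

namespace CoupledSystem

variable (S : CoupledSystem)

/-! ### Fundamental domains -/

/-- The speed of the phase along a curve with derivative `b • duF`. -/
theorem hasDerivAt_phase_comp {η : ℝ → Cover 3} {b : ℝ → ℝ}
    (hη : ∀ t, HasDerivAt η (b t • S.duF (η t)) t) (t : ℝ) :
    HasDerivAt (S.phase ∘ η) (b t * (S.slope (η t) + S.shear (η t))) t := by
  refine ((S.hasFDerivAt_phase (η t)).comp_hasDerivAt t (hη t)).congr_deriv ?_
  change b t * S.slope (η t) + S.r.deriv (η t 0 : ℝ) * (b t * S.du (proj (horizontal (η t))) 0) = _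
  rw [shear]
  ring

/-- Curves tangent to the strong unstable field, pulled back by `F`. -/
theorem exists_hasDerivAt_symm_comp {γ : ℝ → Cover 3} (hγ : IsTangentCurve S.Euf γ) :
    ∃ b : ℝ → ℝ, Continuous (fun t => |b t|) ∧ (∀ t, b t ≠ 0) ∧
      ∀ t, HasDerivAt (S.F.lift.symm ∘ γ) (b t • S.duF (S.F.lift.symm (γ t))) t := by
  have hex : ∀ t, ∃ a : ℝ, a • S.duF (γ t) = deriv γ t := fun t => by
    have h := hγ.tangent t
    rwa [S.Euf_eq_span, Submodule.mem_span_singleton] at h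
  choose a ha using hex
  set η : ℝ → Cover 3 := S.F.lift.symm ∘ γ with hη
  set b : ℝ → ℝ := fun t => a t * (S.αu (proj (horizontal (S.F.lift.symm (γ t)))))⁻¹ with hb
  have hd : ∀ t, HasDerivAt η (b t • S.duF (η t)) t := by
    intro t
    have h1 := (S.F.differentiable_lift_symm (γ t)).hasFDerivAt.comp_hasDerivAt t
      (hγ.contDiff.differentiable (by simp) t).hasDerivAt
    rwa [← ha, map_smul, TorusDiffeo.fderiv_symm_of_invariant
      (m := fun p => S.αu (proj (horizontal p))) (fun _ => (S.αu_pos _).ne') S.map_duF,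
      smul_smul] at h1
  have hb0 : ∀ t, b t ≠ 0 := fun t => by
    refine mul_ne_zero (fun h => hγ.deriv_ne_zero t ?_) (inv_ne_zero (S.αu_pos _).ne')
    rw [← ha, h, zero_smul]
  have hη1 : ContDiff ℝ 1 η := (S.F.contDiff_lift_symm.of_le (by norm_num)).comp hγ.contDiff
  have hdc : Continuous fun t => horizontal (deriv η t) :=
    horizontalL.continuous.comp (hη1.continuous_deriv le_rfl)
  have habs : ∀ t, ‖horizontal (deriv η t)‖ = |b t| := fun t => by
    rw [(hd t).deriv, horizontal_smul, S.horizontal_duF, norm_smul, S.norm_du, mul_one,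
      Real.norm_eq_abs]
  refine ⟨b, ?_, hb0, hd⟩
  simpa only [habs] using hdc.norm

theorem vertical_eq (p : Cover 3) :
    vertical p = S.g.toEquiv (S.phase (S.F.lift.symm p) : UnitAddCircle) := by
  rw [← S.g.coe_lift, ← S.F_lift_two, Equiv.apply_symm_apply]
  rfl

/-- A derivative without zeros makes the phase injective along an unstable curve. -/
theorem phase_comp_injective {η : ℝ → Cover 3} {b : ℝ → ℝ}
    (hη : ∀ t, HasDerivAt η (b t • S.duF (η t)) t) (hb : ∀ t, b t ≠ 0) :
    Function.Injective (S.phase ∘ η) := by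
  have hd := S.hasDerivAt_phase_comp hη
  have hne : ∀ t, b t * (S.slope (η t) + S.shear (η t)) ≠ 0 := fun t =>
    mul_ne_zero (hb t) (add_pos (S.slope_pos _) (S.shear_pos _)).ne'
  have hlt : ∀ t t', t < t' → (S.phase ∘ η) t ≠ (S.phase ∘ η) t' := by
    intro t t' htt' h
    obtain ⟨u, -, hu⟩ := exists_hasDerivAt_eq_zero htt'
      (fun u _ => (hd u).continuousAt.continuousWithinAt) h (fun u _ => hd u)
    exact hne u hu
  intro t t' h
  rcases lt_trichotomy t t' with h1 | h1 | h1
  · exact absurd h (hlt _ _ h1)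
  · exact h1
  · exact absurd h.symm (hlt _ _ h1)

variable {S}

/-- By minimality, a fundamental domain crosses every fiber coordinate exactly once. -/
theorem IsFundamentalDomain.bijOn {γ : ℝ → Cover 3} {J : Set ℝ}
    (h : S.IsFundamentalDomain γ J)
    (hinj : Function.Injective (S.phase ∘ (S.F.lift.symm ∘ γ))) :
    BijOn (fun t => ((S.phase ∘ (S.F.lift.symm ∘ γ)) t : UnitAddCircle)) J univ := by
  have hγ : Function.Injective γ := fun t t' htt' => hinj (by simp [htt'])
  refine ⟨fun _ _ => mem_univ _, ?_, ?_⟩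
  · intro t ht t' ht' hs
    by_contra hne
    refine h.minimal (γ '' J \ {γ t}) ⟨sdiff_subset, fun hsub => ?_⟩ ?_
    · exact (hsub ⟨t, ht, rfl⟩).2 rfl
    · rw [eq_univ_iff_forall]
      intro z
      obtain ⟨_, ⟨u, hu, rfl⟩, rfl⟩ := (h.surj.symm ▸ mem_univ z : z ∈ vertical '' (γ '' J))
      by_cases hut : γ u = γ t
      · refine ⟨γ t', ⟨⟨t', ht', rfl⟩, fun h' => hne (hγ h').symm⟩, ?_⟩
        rw [hut, S.vertical_eq, S.vertical_eq]
        exact congrArg S.g.toEquiv hs.symm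
      · exact ⟨γ u, ⟨⟨u, hu, rfl⟩, hut⟩, rfl⟩
  · intro z _
    obtain ⟨_, ⟨u, hu, rfl⟩, hz⟩ := (h.surj.symm ▸ mem_univ (S.g.toEquiv z) :
      S.g.toEquiv z ∈ vertical '' (γ '' J))
    rw [S.vertical_eq] at hz
    exact ⟨u, hu, S.g.toEquiv.injective hz⟩

theorem IsFundamentalDomain.volume_pos {γ : ℝ → Cover 3} {J : Set ℝ}
    (h : S.IsFundamentalDomain γ J) : 0 < volume J := by
  have hJ : J.Nontrivial := by
    by_contra hJ
    rw [not_nontrivial_iff] at hJ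
    have hsub := (hJ.image γ).image vertical
    rw [h.surj] at hsub
    have h2 : ((1 / 2 : ℝ) : UnitAddCircle) = 0 := hsub (mem_univ _) (mem_univ _)
    rw [AddCircle.coe_eq_zero_iff] at h2
    obtain ⟨n, hn⟩ := h2
    have h3 : (2 * n : ℝ) = 1 := by
      rw [zsmul_eq_mul, mul_one] at hn; linarith
    have h4 : 2 * n = 1 := by exact_mod_cast h3
    omega
  obtain ⟨x, hx, y, hy, hxy⟩ := hJ.exists_lt
  refine lt_of_lt_of_le ?_ (measure_mono (h.ordConnected.out hx hy))
  simpa using hxy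

/-! ### The contracting center condition -/

/-- On `F⁻¹V` the reference measure is comparable to the phase: writing `w` for its density with
respect to the curve parameter, `m |s'| ≤ w ≤ m R |s'|` with `R` the factor of the weighted mean.
The phase covers the circle once, so that the mean of `log g'` is at most `m` times the weighted
mean, and `m R ≥ 1` as `w` integrates to one. -/
theorem IsFundamentalDomain.exists_density {γ : ℝ → Cover 3} {J : Set ℝ}
    (h : S.IsFundamentalDomain γ J) {K : ℝ} (hK : S.IsDistortionConstant K)
    (hneg : S.weightedMean K < 0) :
    0 < S.C * K ^ 2 / (S.c * S.β) * (1 + 2 * S.lamMax / (S.αuMin - S.lamMax)) ∧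
    ∃ ρ : Cover 3 → ℝ, IsReferenceDensity S.F S.Euf (S.F.lift.symm ∘ γ) J ρ ∧
      arcIntegral (S.F.lift.symm ∘ γ) J
        (fun p => Real.log (dilation S.F Ec p) * ρ p) ≤ S.weightedMean K /
          (S.C * K ^ 2 / (S.c * S.β) * (1 + 2 * S.lamMax / (S.αuMin - S.lamMax))) := by
  obtain ⟨b, hbc, hb0, hη⟩ := S.exists_hasDerivAt_symm_comp h.curve
  set η : ℝ → Cover 3 := S.F.lift.symm ∘ γ with hηdef
  have hJm : MeasurableSet J := h.ordConnected.measurableSet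
  obtain ⟨ρ, hρA, hρF⟩ := S.exists_isReferenceDensity hη hb0 hbc h.bounded h.volume_pos
  obtain ⟨t₀, ht₀⟩ : J.Nonempty := nonempty_of_measure_ne_zero h.volume_pos.ne'
  have hρ0 : ∀ t ∈ J, 0 < ρ (horizontal (η t)) := fun t ht => hρA.pos _ ⟨t, ht, rfl⟩
  have hratio : ∀ t ∈ J, ∀ t' ∈ J, ρ (horizontal (η t)) ≤ K * ρ (horizontal (η t')) :=
    fun t ht t' ht' => by
      rw [← div_le_iff₀ (hρ0 t' ht')]
      exact hK γ J h ρ hρA _ ⟨t, ht, rfl⟩ _ ⟨t', ht', rfl⟩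
  have hK1 : 1 ≤ K := by
    have h1 := hratio t₀ ht₀ t₀ ht₀
    have h2 := hρ0 t₀ ht₀
    nlinarith
  have hK0 : 0 < K := one_pos.trans_le hK1
  have hC := S.C_pos
  have hcβ := mul_pos S.c_pos S.β_pos
  have hgap := sub_pos.2 S.lamMax_lt_αuMin
  have hlam := S.lamMax_pos
  set κ := S.lamMax / (S.αuMin - S.lamMax) with hκ
  have hκ0 : 0 < κ := by positivity
  have hR : S.C * K ^ 2 / (S.c * S.β) * (1 + 2 * S.lamMax / (S.αuMin - S.lamMax))
      = S.C * K ^ 2 / (S.c * S.β) * (1 + 2 * κ) := by rw [hκ]; ring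
  have hWM : S.weightedMean K = (S.C * K ^ 2 / (S.c * S.β) * (1 + 2 * κ)) *
      (∫ s in {s : UnitAddCircle | 1 ≤ S.g.deriv s}, Real.log (S.g.deriv s)) +
    ∫ s in {s : UnitAddCircle | S.g.deriv s < 1}, Real.log (S.g.deriv s) := by
    rw [← hR]; rfl
  rw [hR]
  set R := S.C * K ^ 2 / (S.c * S.β) * (1 + 2 * κ) with hRdef
  have hR0 : 0 < R := by positivity
  refine ⟨hR0, _, hρF, ?_⟩
  set s : ℝ → ℝ := S.phase ∘ η with hsdef
  set v : ℝ → ℝ := fun t => S.slope (η t) + S.shear (η t) with hv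
  have hs : ∀ t, HasDerivAt s (b t * v t) t := S.hasDerivAt_phase_comp hη
  have hsc : Continuous s := continuous_iff_continuousAt.2 fun t => (hs t).continuousAt
  have hbij : BijOn (fun t => (s t : UnitAddCircle)) J univ :=
    h.bijOn (S.phase_comp_injective hη hb0)
  have hvle : ∀ t, v t ≤ S.C * (1 + κ) := fun t => by
    have h1 := S.slope_le (η t)
    have h2 := S.shear_le (η t)
    simp only [hv]
    linarith
  have hlev : ∀ t, S.c * S.β ≤ v t := fun t => by
    have h1 := S.slope_nonneg (η t)
    have h2 := S.le_shear (η t)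
    simp only [hv]
    linarith
  have hv0 : ∀ t, 0 < v t := fun t => hcβ.trans_le (hlev t)
  -- the density with respect to the parameter `t`, which is the same for `F` and for `A`
  set w : ℝ → ℝ := fun t => ρ (horizontal (η t)) * |b t| with hw
  have hw1 : ∫ t in J, w t = 1 := by
    rw [← hρA.integral_eq_one]
    unfold arcIntegral
    simp only [S.norm_deriv_horizontal hη]
    rfl
  have hwi : IntegrableOn w J := by
    by_contra hni
    rw [integral_undef hni] at hw1
    exact zero_ne_one hw1
  set m := ρ (horizontal (η t₀)) / (K * (S.C * (1 + κ))) with hm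
  have hm0 : 0 < m := by
    have := hρ0 t₀ ht₀
    positivity
  have habs : ∀ t, |b t * v t| = |b t| * v t := fun t => by rw [abs_mul, abs_of_pos (hv0 t)]
  have hlow : ∀ t ∈ J, m * |b t * v t| ≤ w t := fun t ht => by
    rw [habs]
    have h1 : m * v t ≤ ρ (horizontal (η t)) := by
      have h2 := hratio t₀ ht₀ t ht
      calc m * v t ≤ m * (S.C * (1 + κ)) := by gcongr; exact hvle t
        _ = ρ (horizontal (η t₀)) / K := by rw [hm]; field_simp
        _ ≤ _ := by rwa [div_le_iff₀' hK0]
    calc m * (|b t| * v t) = (m * v t) * |b t| := by ring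
      _ ≤ _ := mul_le_mul_of_nonneg_right h1 (abs_nonneg _)
  have hupp : ∀ t ∈ J, w t ≤ m * R * |b t * v t| := fun t ht => by
    rw [habs]
    have h1 : ρ (horizontal (η t)) ≤ m * R * v t := by
      have h2 := hratio t ht t₀ ht₀
      have h3 := hρ0 t₀ ht₀
      calc ρ (horizontal (η t)) ≤ K * ρ (horizontal (η t₀)) := h2
        _ = (m * (S.C * K ^ 2 / (S.c * S.β) * (1 + κ))) * (S.c * S.β) := by
            rw [hm]
            have h4 := S.c_pos.ne'
            have h5 := S.β_pos.ne'
            field_simp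
        _ ≤ m * R * v t := by
            gcongr m * ?_ * ?_
            · rw [hRdef]
              gcongr
              linarith
            · exact hlev t
    calc w t = ρ (horizontal (η t)) * |b t| := rfl
      _ ≤ (m * R * v t) * |b t| := by gcongr
      _ = _ := by ring
  have hmeas' : Measurable fun t => b t * v t := by
    have : (fun t => b t * v t) = deriv s := funext fun t => (hs t).deriv.symm
    rw [this]
    exact measurable_deriv s
  have hsi : IntegrableOn (fun t => |b t * v t|) J := by
    refine Integrable.mono' (hwi.const_mul m⁻¹) hmeas'.abs.aestronglyMeasurable ?_
    refine (ae_restrict_mem hJm).mono fun t ht => ?_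
    rw [Real.norm_eq_abs, abs_abs, ← div_eq_inv_mul, le_div_iff₀' hm0]
    exact hlow t ht
  -- the total mass is one and the phase has total variation one
  have hmR : 1 / R ≤ m := by
    have h1 := setIntegral_mono_on hwi (hsi.const_mul (m * R)) hJm hupp
    have h2 := setIntegral_abs_deriv_mul_comp hs hJm hbij (fun _ => 1)
    simp only [mul_one, integral_const, smul_eq_mul] at h2
    rw [integral_const_mul, hw1, h2] at h1
    rw [measureReal_def, UnitAddCircle.measure_univ, ENNReal.toReal_one, mul_one] at h1
    rwa [div_le_iff₀ hR0]
  obtain ⟨M, hM⟩ : ∃ M, ∀ z, ‖Real.log (S.g.deriv z)‖ ≤ M := by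
    obtain ⟨M, hM⟩ := isCompact_univ.exists_bound_of_continuousOn
      S.g.continuous_log_deriv.continuousOn
    exact ⟨M, fun z => hM z (mem_univ z)⟩
  have hcoe : Continuous fun t => ((s t : ℝ) : UnitAddCircle) :=
    (AddCircle.continuous_mk' 1).comp hsc
  have hLi : IntegrableOn (fun t => Real.log (S.g.deriv (s t : ℝ)) * w t) J :=
    Integrable.bdd_mul hwi
      (S.g.continuous_log_deriv.comp hcoe).aestronglyMeasurable
      (ae_of_all _ fun t => hM _)
  have hψM : ∀ z, ‖S.g.weightedLog R z‖ ≤ (R + 1) * M := fun z => by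
    have hMz := hM z
    have hM0 := (norm_nonneg _).trans hMz
    rcases le_or_gt 1 (S.g.deriv z) with hz | hz
    · rw [S.g.weightedLog_of_le hz, norm_mul, Real.norm_eq_abs, abs_of_pos hR0]
      nlinarith
    · rw [S.g.weightedLog_of_lt hz]
      nlinarith
  have hψi : IntegrableOn (fun t => |b t * v t| * S.g.weightedLog R (s t : ℝ)) J :=
    Integrable.mul_bdd hsi
      ((S.g.measurable_weightedLog R).comp hcoe.measurable).aestronglyMeasurable
      (ae_of_all _ fun t => hψM _)
  -- `w` is bounded from above where `log g' ≥ 0` and from below where `log g' < 0`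
  have hpoint : ∀ t ∈ J, Real.log (S.g.deriv (s t : ℝ)) * w t
      ≤ m * (|b t * v t| * S.g.weightedLog R (s t : ℝ)) := fun t ht => by
    rcases le_or_gt 1 (S.g.deriv (s t : ℝ)) with hz | hz
    · rw [S.g.weightedLog_of_le hz]
      have h1 := mul_le_mul_of_nonneg_left (hupp t ht) (Real.log_nonneg hz)
      linarith
    · rw [S.g.weightedLog_of_lt hz]
      have h1 := mul_le_mul_of_nonpos_left (hlow t ht)
        (Real.log_nonpos (S.g.deriv_pos _).le hz.le)
      linarith
  have hfinal := setIntegral_mono_on hLi (hψi.const_mul m) hJm hpoint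
  rw [integral_const_mul, setIntegral_abs_deriv_mul_comp hs hJm hbij,
    S.g.integral_weightedLog, ← hWM] at hfinal
  have hlhs : arcIntegral η J (fun p => Real.log (dilation S.F Ec p)
      * (ρ (horizontal p) / ‖S.duF p‖)) = ∫ t in J, Real.log (S.g.deriv (s t : ℝ)) * w t := by
    unfold arcIntegral
    congr 1
    funext t
    have := (S.norm_duF_pos (η t)).ne'
    rw [(hη t).deriv, norm_smul, Real.norm_eq_abs]
    simp only [S.dilation_center]
    change Real.log (S.g.deriv (s t : ℝ)) * (ρ (horizontal (η t)) / ‖S.duF (η t)‖)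
      * (|b t| * ‖S.duF (η t)‖) = _
    simp only [hw]
    field_simp
  rw [hlhs]
  refine hfinal.trans ?_
  rw [div_eq_mul_one_div, mul_comm]
  exact mul_le_mul_of_nonpos_left hmR hneg.le

theorem contractingCenter_of_weightedMean_neg {K : ℝ} (hK : S.IsDistortionConstant K)
    (hneg : S.weightedMean K < 0) : S.ContractingCenter := by
  by_cases hex : ∃ (γ : ℝ → Cover 3) (J : Set ℝ), S.IsFundamentalDomain γ J
  · obtain ⟨γ, J, h⟩ := hex
    have hR := (h.exists_density hK hneg).1
    refine ⟨_, div_pos (neg_pos.2 hneg) hR, fun γ' J' h' => ?_⟩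
    obtain ⟨ρ, hρ, hle⟩ := (h'.exists_density hK hneg).2
    refine ⟨ρ, hρ, hle.trans_eq ?_⟩
    ring
  · exact ⟨1, one_pos, fun γ J h => absurd ⟨γ, J, h⟩ hex⟩

end CoupledSystem

/-! ### The mean of the logarithmic derivative of a circle diffeomorphism -/

theorem eq_zero_of_integral_eq_zero {f : UnitAddCircle → ℝ} (hf : Continuous f)
    (h0 : ∀ z, 0 ≤ f z) (h : ∫ z, f z = 0) (z : UnitAddCircle) : f z = 0 := by
  have hi : Integrable f :=
    hf.integrable_of_hasCompactSupport (HasCompactSupport.of_compactSpace _)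
  rw [integral_eq_zero_iff_of_nonneg h0 hi] at h
  exact congrFun ((hf.ae_eq_iff_eq (μ := volume) continuous_const).1 h) z

namespace CircleDiffeo

variable (g : CircleDiffeo)

theorem strictMono_lift : StrictMono g.lift := strictMono_of_deriv_pos g.deriv_lift_pos

/-- A lift of a circle diffeomorphism has degree one. -/
theorem lift_one_sub_lift_zero : g.lift 1 - g.lift 0 = 1 := by
  have hc : Continuous g.lift := g.contDiff_lift.continuous
  have h : ((g.lift 1 - g.lift 0 : ℝ) : UnitAddCircle) = 0 := by
    have h1 : ((1 : ℝ) : UnitAddCircle) = ((0 : ℝ) : UnitAddCircle) := AddCircle.coe_period 1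
    rw [AddCircle.coe_sub, g.coe_lift, g.coe_lift, h1, sub_self]
  obtain ⟨m, hm⟩ := (AddCircle.coe_eq_zero_iff (1 : ℝ)).1 h
  rw [zsmul_eq_mul, mul_one] at hm
  have hpos : (0 : ℝ) < m := by
    rw [hm]
    exact sub_pos.2 (g.strictMono_lift one_pos)
  have hm1 : 1 ≤ m := by exact_mod_cast hpos
  by_contra hne
  have hm2 : 1 < m := lt_of_le_of_ne hm1 fun h' => hne (by rw [← hm, ← h']; simp)
  have hm2' : (1 : ℝ) < m := by exact_mod_cast hm2
  -- otherwise the lift takes the value `g.lift 0 + 1` strictly before time one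
  obtain ⟨y, ⟨hy0, hy1⟩, hy⟩ := intermediate_value_Ioo (zero_le_one (α := ℝ)) hc.continuousOn
    (show g.lift 0 + 1 ∈ Ioo (g.lift 0) (g.lift 1) from ⟨by linarith, by linarith⟩)
  have h3 : g.toEquiv (y : UnitAddCircle) = g.toEquiv ((0 : ℝ) : UnitAddCircle) := by
    rw [← g.coe_lift, ← g.coe_lift, hy, AddCircle.coe_add, AddCircle.coe_period, add_zero]
  have h4 : ((y : ℝ) : UnitAddCircle) = 0 := g.toEquiv.injective h3
  obtain ⟨n, hn⟩ := (AddCircle.coe_eq_zero_iff (1 : ℝ)).1 h4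
  rw [zsmul_eq_mul, mul_one] at hn
  rw [← hn] at hy0 hy1
  have h5 : 0 < n := by exact_mod_cast hy0
  have h6 : n < 1 := by exact_mod_cast hy1
  omega

theorem integrable_deriv : Integrable g.deriv :=
  g.continuous_deriv.integrable_of_hasCompactSupport (HasCompactSupport.of_compactSpace _)

theorem integral_deriv : ∫ z, g.deriv z = 1 := by
  rw [← UnitAddCircle.intervalIntegral_preimage 0, zero_add]
  simp only [g.deriv_coe]
  rw [intervalIntegral.integral_deriv_eq_sub (fun x _ => g.differentiable_lift x)
    (g.contDiff_deriv_lift.continuous.intervalIntegrable _ _), g.lift_one_sub_lift_zero]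

/-- By Jensen's inequality the mean of `log g'` is negative unless `g` is a rotation. -/
theorem integral_log_deriv_neg (hg : ∃ z, g.deriv z ≠ 1) : ∫ z, Real.log (g.deriv z) < 0 := by
  have h1 : Integrable (fun _ : UnitAddCircle => (1 : ℝ)) := integrable_const 1
  have hval : ∫ z, (g.deriv z - 1 - Real.log (g.deriv z)) = - ∫ z, Real.log (g.deriv z) := by
    have h2 : Integrable (fun z => g.deriv z - 1) := g.integrable_deriv.sub h1
    rw [integral_sub h2 g.integrable_log_deriv,
      integral_sub g.integrable_deriv h1, g.integral_deriv, integral_const, measureReal_def,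
      UnitAddCircle.measure_univ]
    simp
  have hnn : ∀ z, 0 ≤ g.deriv z - 1 - Real.log (g.deriv z) := fun z => by
    have := Real.log_le_sub_one_of_pos (g.deriv_pos z)
    linarith
  have hle : 0 ≤ ∫ z, (g.deriv z - 1 - Real.log (g.deriv z)) := integral_nonneg hnn
  refine lt_of_le_of_ne (by linarith) fun h0 => ?_
  obtain ⟨z, hz⟩ := hg
  have h2 := eq_zero_of_integral_eq_zero (f := fun z => g.deriv z - 1 - Real.log (g.deriv z))
    ((g.continuous_deriv.sub continuous_const).sub g.continuous_log_deriv) hnn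
    (by rw [hval, h0, neg_zero]) z
  have h3 := Real.log_lt_sub_one_of_pos (g.deriv_pos z) hz
  linarith

end CircleDiffeo

namespace IsNorthSouth

variable {g : CircleDiffeo} {zr za : UnitAddCircle}

/-- A north-south map is not an isometry: a rotation with a fixed point is the identity. -/
theorem exists_deriv_ne_one (h : IsNorthSouth g zr za) : ∃ z, g.deriv z ≠ 1 := by
  by_contra! hall
  have hd : ∀ x : ℝ, HasDerivAt (fun x => g.lift x - x) 0 x := fun x => by
    have h1 := (g.hasDerivAt_lift x).sub (hasDerivAt_id x)
    rwa [hall, sub_self] at h1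
  have hconst : ∀ x, g.lift x - x = g.lift 0 - 0 := fun x =>
    is_const_of_deriv_eq_zero (fun y => (hd y).differentiableAt) (fun y => (hd y).deriv) x 0
  have hrot : ∀ z : UnitAddCircle, g.toEquiv z = z + ((g.lift 0 : ℝ) : UnitAddCircle) := by
    intro z
    obtain ⟨x, rfl⟩ := QuotientAddGroup.mk_surjective z
    have h1 : g.lift x = x + g.lift 0 := by linarith [hconst x]
    have h2 := g.coe_lift x
    rw [h1, AddCircle.coe_add] at h2
    exact h2.symm
  have h0 : ((g.lift 0 : ℝ) : UnitAddCircle) = 0 := by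
    have h1 := hrot zr
    rw [h.fixed_r] at h1
    exact left_eq_add.1 h1
  have hid : ⇑g.toEquiv = id := funext fun z => by rw [hrot, h0, add_zero, id]
  have hI : Infinite (Ico (0 : ℝ) (0 + 1)) := (Ico_infinite (by norm_num)).to_subtype
  have hinf : Infinite UnitAddCircle :=
    Infinite.of_injective (fun x : Ico (0 : ℝ) (0 + 1) => ((x : ℝ) : UnitAddCircle))
      (AddCircle.equivIco 1 0).symm.injective
  obtain ⟨z, hz⟩ := (Set.toFinite {zr, za}).infinite_compl.nonempty
  simp only [mem_compl_iff, mem_insert_iff, mem_singleton_iff, not_or] at hz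
  have hlim := h.tendsto_a z hz.1 hz.2
  rw [hid] at hlim
  simp only [Function.iterate_id, id] at hlim
  exact hz.2 (tendsto_nhds_unique tendsto_const_nhds hlim)

theorem deriv_za_lt_one (h : IsNorthSouth g zr za) : g.deriv za < 1 := by
  by_contra! hge
  obtain ⟨z, hz⟩ := h.exists_deriv_ne_one
  have h2 := eq_zero_of_integral_eq_zero (f := fun z => g.deriv z - 1) (g.continuous_deriv.sub continuous_const)
    (fun z => sub_nonneg.2 (hge.trans (h.le_deriv z))) (by
      rw [integral_sub g.integrable_deriv (integrable_const 1), g.integral_deriv, integral_const,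
        measureReal_def, UnitAddCircle.measure_univ]
      simp) z
  exact hz (sub_eq_zero.1 h2)

theorem one_lt_deriv_zr (h : IsNorthSouth g zr za) : 1 < g.deriv zr := by
  by_contra! hle
  obtain ⟨z, hz⟩ := h.exists_deriv_ne_one
  have h2 := eq_zero_of_integral_eq_zero (f := fun z => 1 - g.deriv z) (continuous_const.sub g.continuous_deriv)
    (fun z => sub_nonneg.2 ((h.deriv_le z).trans hle)) (by
      rw [integral_sub (integrable_const 1) g.integrable_deriv, g.integral_deriv, integral_const,
        measureReal_def, UnitAddCircle.measure_univ]
      simp) z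
  exact hz (sub_eq_zero.1 h2).symm

end IsNorthSouth

/-! ### The linear example -/

/-- The linear map with matrix `[[N, N - 1], [1, 1]]`. -/
def linearMap (N : ℕ) : Cover 2 →L[ℝ] Cover 2 :=
  LinearMap.toContinuousLinearMap
    { toFun := (linearBase N).lift
      map_add' := fun x y => by
        ext i
        fin_cases i <;> simp [linearBase] <;> ring
      map_smul' := fun a x => by
        ext i
        fin_cases i <;> simp [linearBase] <;> ring }

theorem fderiv_linearBase (N : ℕ) (x : Cover 2) :
    fderiv ℝ (linearBase N).lift x = linearMap N :=
  (linearMap N).hasFDerivAt.fderiv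

/-- The eigenvector for a root `ν` of the characteristic polynomial. -/
def eigenvector (ν : ℝ) : Cover 2 := !₂[ν - 1, 1]

theorem linearMap_eigenvector {N : ℕ} {ν : ℝ} (hν : ν ^ 2 - (N + 1) * ν + 1 = 0) :
    linearMap N (eigenvector ν) = ν • eigenvector ν := by
  ext i
  fin_cases i
  · change (N : ℝ) * (ν - 1) + ((N : ℝ) - 1) * 1 = ν * (ν - 1)
    linear_combination -hν
  · change (ν - 1) + 1 = ν * 1
    ring

theorem eigenvector_ne_zero (ν : ℝ) : eigenvector ν ≠ 0 := fun h => by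
  have := congrArg (fun v : Cover 2 => v 1) h
  simp [eigenvector] at this

theorem norm_eigenvector_pos (ν : ℝ) : 0 < ‖eigenvector ν‖ :=
  norm_pos_iff.2 (eigenvector_ne_zero ν)

/-- The unit vector in the direction of `eigenvector ν`. -/
def unitEigenvector (ν : ℝ) : Cover 2 := ‖eigenvector ν‖⁻¹ • eigenvector ν

theorem norm_unitEigenvector (ν : ℝ) : ‖unitEigenvector ν‖ = 1 := by
  rw [unitEigenvector, norm_smul, norm_inv, norm_norm, inv_mul_cancel₀ (norm_eigenvector_pos ν).ne']

theorem unitEigenvector_zero (ν : ℝ) : unitEigenvector ν 0 = (ν - 1) / ‖eigenvector ν‖ := by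
  change ‖eigenvector ν‖⁻¹ * (ν - 1) = _
  rw [div_eq_inv_mul]

theorem linearMap_unitEigenvector {N : ℕ} {ν : ℝ} (hν : ν ^ 2 - (N + 1) * ν + 1 = 0) :
    linearMap N (unitEigenvector ν) = ν • unitEigenvector ν := by
  rw [unitEigenvector, map_smul, linearMap_eigenvector hν, smul_comm]

theorem map_span_eigenvector {N : ℕ} {ν : ℝ} (hν : ν ^ 2 - (N + 1) * ν + 1 = 0) (h0 : ν ≠ 0) :
    (Submodule.span ℝ {eigenvector ν}).map (linearMap N).toLinearMap
      = Submodule.span ℝ {eigenvector ν} := by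
  rw [LinearMap.map_span, image_singleton, ContinuousLinearMap.coe_coe, linearMap_eigenvector hν,
    Submodule.span_singleton_smul_eq (IsUnit.mk0 ν h0)]

theorem isCompl_span_eigenvector {ν μ : ℝ} (h : ν ≠ μ) :
    IsCompl (Submodule.span ℝ {eigenvector ν}) (Submodule.span ℝ {eigenvector μ}) := by
  constructor
  · rw [Submodule.disjoint_def]
    intro v hv hv'
    obtain ⟨a, rfl⟩ := Submodule.mem_span_singleton.1 hv
    obtain ⟨b, hb⟩ := Submodule.mem_span_singleton.1 hv'
    have h0 : b * (μ - 1) = a * (ν - 1) := congrArg (fun v : Cover 2 => v 0) hb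
    have h1 : b * 1 = a * 1 := congrArg (fun v : Cover 2 => v 1) hb
    have h2 : a * (ν - μ) = 0 := by linear_combination (μ - 1) * h1 - h0
    rw [(mul_eq_zero.1 h2).resolve_right (sub_ne_zero.2 h), zero_smul]
  · rw [codisjoint_iff, Submodule.eq_top_iff']
    intro v
    have hne : ν - μ ≠ 0 := sub_ne_zero.2 h
    refine Submodule.mem_sup.2
      ⟨((v 0 + v 1 - μ * v 1) / (ν - μ)) • eigenvector ν, Submodule.smul_mem _ _
        (Submodule.mem_span_singleton_self _),
      (v 1 - (v 0 + v 1 - μ * v 1) / (ν - μ)) • eigenvector μ, Submodule.smul_mem _ _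
        (Submodule.mem_span_singleton_self _), ?_⟩
    ext i
    fin_cases i
    · change (v 0 + v 1 - μ * v 1) / (ν - μ) * (ν - 1)
        + (v 1 - (v 0 + v 1 - μ * v 1) / (ν - μ)) * (μ - 1) = v 0
      field_simp
      ring
    · change (v 0 + v 1 - μ * v 1) / (ν - μ) * 1
        + (v 1 - (v 0 + v 1 - μ * v 1) / (ν - μ)) * 1 = v 1
      ring

theorem isAnosov_linearBase {N : ℕ} {μ : ℝ} (hμ : μ ^ 2 - (N + 1) * μ + 1 = 0) (h1 : 1 < μ) :
    IsAnosov (linearBase N) μ⁻¹ (fun _ => Submodule.span ℝ {eigenvector μ⁻¹})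
      (fun _ => Submodule.span ℝ {eigenvector μ}) := by
  have h0 : 0 < μ := one_pos.trans h1
  have hinv : μ⁻¹ < 1 := inv_lt_one_of_one_lt₀ h1
  have hν : μ⁻¹ ^ 2 - (N + 1) * μ⁻¹ + 1 = 0 := by
    field_simp
    linear_combination hμ
  refine ⟨hinv, fun _ => finrank_span_singleton (eigenvector_ne_zero _),
    fun _ => finrank_span_singleton (eigenvector_ne_zero _),
    fun _ => isCompl_span_eigenvector (hinv.trans h1).ne, fun x => ?_, fun x => ?_,
    fun x w hw => ?_, fun x v hv => ?_⟩
  · rw [fderiv_linearBase, map_span_eigenvector hν (inv_pos.2 h0).ne']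
  · rw [fderiv_linearBase, map_span_eigenvector hμ h0.ne']
  · obtain ⟨a, rfl⟩ := Submodule.mem_span_singleton.1 hw
    rw [fderiv_linearBase, map_smul, linearMap_eigenvector hν, smul_comm, norm_smul,
      Real.norm_eq_abs, abs_of_pos (inv_pos.2 h0)]
  · obtain ⟨a, rfl⟩ := Submodule.mem_span_singleton.1 hv
    rw [map_smul, TorusDiffeo.fderiv_symm_of_invariant (X := fun _ => eigenvector μ)
      (m := fun _ => μ) (fun _ => h0.ne')
      (fun y => by rw [fderiv_linearBase, linearMap_eigenvector hμ]), smul_comm, norm_smul,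
      Real.norm_eq_abs, abs_of_pos (inv_pos.2 h0)]

/-- The unit unstable vector of the linear map is almost horizontal when `μ` is large. -/
theorem le_unitEigenvector_zero {μ : ℝ} (h1 : 1 < μ) : (μ - 1) / μ ≤ unitEigenvector μ 0 := by
  rw [unitEigenvector_zero]
  have hnorm : ‖eigenvector μ‖ ≤ μ := by
    refine le_of_sq_le_sq ?_ (by linarith)
    rw [norm_sq_cover_two]
    change (μ - 1) ^ 2 + 1 ^ 2 ≤ μ ^ 2
    nlinarith
  have := norm_eigenvector_pos μ
  gcongr

/-- The coupled system over the linear map with matrix `[[N, N - 1], [1, 1]]`, where `μ > 1` is the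
larger eigenvalue. -/
def linearSystem {N : ℕ} {μ : ℝ} (hμ : μ ^ 2 - (N + 1) * μ + 1 = 0) (h1 : 1 < μ)
    {g : CircleDiffeo} {zr za : UnitAddCircle} (hg : IsNorthSouth g zr za)
    (hmin : μ⁻¹ < g.deriv za) (hmax : g.deriv zr < μ) {r : CircleDiffeo}
    (hr : ∀ z, r.deriv z = 1) : CoupledSystem where
  A := linearBase N
  lam := μ⁻¹
  Es := fun _ => Submodule.span ℝ {eigenvector μ⁻¹}
  Eu := fun _ => Submodule.span ℝ {eigenvector μ}
  anosov := isAnosov_linearBase hμ h1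
  g := g
  zr := zr
  za := za
  northSouth := hg
  r := r
  lam_lt := hmin
  min_lt_one := hg.deriv_za_lt_one
  one_lt_max := hg.one_lt_deriv_zr
  max_lt := by rwa [inv_inv]
  c := 1
  C := 1
  c_pos := one_pos
  c_le := fun z => (hr z).ge
  le_C := fun z => (hr z).le
  du := fun _ => unitEigenvector μ
  ds := fun _ => unitEigenvector μ⁻¹
  du_mem := fun _ => Submodule.smul_mem _ _ (Submodule.mem_span_singleton_self _)
  ds_mem := fun _ => Submodule.smul_mem _ _ (Submodule.mem_span_singleton_self _)
  norm_du := fun _ => norm_unitEigenvector _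
  norm_ds := fun _ => norm_unitEigenvector _
  β := (μ - 1) / μ
  β_pos := div_pos (sub_pos.2 h1) (one_pos.trans h1)
  β_le := fun _ => le_unitEigenvector_zero h1
  ds_neg := fun _ => by
    rw [unitEigenvector_zero]
    exact div_neg_of_neg_of_pos (sub_neg.2 (inv_lt_one_of_one_lt₀ h1)) (norm_eigenvector_pos _)
  αu := fun _ => μ
  αs := fun _ => μ⁻¹
  αu_pos := fun _ => one_pos.trans h1
  αs_pos := fun _ => inv_pos.2 (one_pos.trans h1)
  map_du := fun x => by rw [fderiv_linearBase, linearMap_unitEigenvector hμ]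
  map_ds := fun x => by
    rw [fderiv_linearBase, linearMap_unitEigenvector]
    have h0 := one_pos.trans h1
    field_simp
    linear_combination hμ

/-- Without variation of the expansion rate the reference densities are constant. -/
theorem CoupledSystem.isDistortionConstant_one (S : CoupledSystem) {a : ℝ}
    (h : ∀ p, S.αu p = a) : S.IsDistortionConstant 1 := by
  intro γ J _ ρ hρ p hp p' hp'
  have hlim := hρ.ratio p hp p' hp'
  have ha : a ≠ 0 := by
    rw [← h 0]
    exact (S.αu_pos 0).ne'
  simp only [S.dilation_base, h, div_self ha, Finset.prod_const_one] at hlim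
  exact (tendsto_nhds_unique tendsto_const_nhds hlim).ge

/-- The factor of the weighted mean tends to one as the expansion of the base grows, and the limit
of the weighted mean is the mean of `log g'`. -/
theorem eventually_weightedMean_neg {g : CircleDiffeo} {zr za : UnitAddCircle}
    (hg : IsNorthSouth g zr za) :
    ∀ᶠ μ : ℝ in atTop, (1 * 1 ^ 2 / (1 * ((μ - 1) / μ)) *
      (1 + 2 * g.deriv zr / (μ - g.deriv zr))) *
      (∫ s in {s : UnitAddCircle | 1 ≤ g.deriv s}, Real.log (g.deriv s)) +
    ∫ s in {s : UnitAddCircle | g.deriv s < 1}, Real.log (g.deriv s) < 0 := by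
  have hsum : (∫ s in {s : UnitAddCircle | 1 ≤ g.deriv s}, Real.log (g.deriv s)) +
      ∫ s in {s : UnitAddCircle | g.deriv s < 1}, Real.log (g.deriv s) < 0 := by
    rw [← g.compl_expanding, integral_add_compl g.measurableSet_expanding g.integrable_log_deriv]
    exact g.integral_log_deriv_neg hg.exists_deriv_ne_one
  have hβ : Tendsto (fun μ : ℝ => (μ - 1) / μ) atTop (𝓝 1) := by
    have h1 : Tendsto (fun μ : ℝ => 1 - μ⁻¹) atTop (𝓝 (1 - 0)) :=
      tendsto_const_nhds.sub tendsto_inv_atTop_zero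
    rw [sub_zero] at h1
    refine h1.congr' ?_
    filter_upwards [eventually_gt_atTop 0] with μ hμ
    field_simp
  have hdom : Tendsto (fun μ : ℝ => 2 * g.deriv zr / (μ - g.deriv zr)) atTop (𝓝 0) :=
    tendsto_const_nhds.div_atTop (tendsto_atTop_add_const_right _ _ tendsto_id)
  have hR : Tendsto (fun μ : ℝ => 1 * 1 ^ 2 / (1 * ((μ - 1) / μ)) *
      (1 + 2 * g.deriv zr / (μ - g.deriv zr))) atTop (𝓝 1) := by
    have h1 := ((tendsto_const_nhds (x := (1 : ℝ) * 1 ^ 2)).div (hβ.const_mul 1)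
      (by norm_num)).mul (hdom.const_add 1)
    simpa using h1
  have hlim := (hR.mul_const
    (∫ s in {s : UnitAddCircle | 1 ≤ g.deriv s}, Real.log (g.deriv s))).add_const
    (∫ s in {s : UnitAddCircle | g.deriv s < 1}, Real.log (g.deriv s))
  rw [← one_mul (∫ s in {s : UnitAddCircle | 1 ≤ g.deriv s}, Real.log (g.deriv s))] at hsum
  exact hlim.eventually_lt_const hsum

/-- The larger root of the characteristic polynomial `x² - (N + 1) x + 1` is at least `N`. -/
theorem exists_eigenvalue {N : ℕ} (hN : 1 ≤ N) :
    ∃ μ : ℝ, (N : ℝ) ≤ μ ∧ μ ^ 2 - (N + 1) * μ + 1 = 0 := by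
  have hN' : (1 : ℝ) ≤ N := by exact_mod_cast hN
  have hsq : 0 ≤ ((N : ℝ) + 1) ^ 2 - 4 := by nlinarith
  have h1 := Real.sq_sqrt hsq
  have h2 : (N : ℝ) - 1 ≤ √(((N : ℝ) + 1) ^ 2 - 4) := by
    refine Real.le_sqrt_of_sq_le ?_
    nlinarith
  refine ⟨((N + 1) + √(((N : ℝ) + 1) ^ 2 - 4)) / 2, by linarith, ?_⟩
  linear_combination h1 / 4

theorem exists_linearSystem {g : CircleDiffeo} {zr za : UnitAddCircle}
    (hg : IsNorthSouth g zr za) :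
    ∃ N₀ : ℕ, ∀ N : ℕ, N₀ ≤ N → ∀ r : CircleDiffeo, (∀ z, r.deriv z = 1) →
      ∃ S : CoupledSystem,
        S.A = linearBase N ∧ S.g = g ∧ S.zr = zr ∧ S.za = za ∧ S.r = r ∧
        S.c = 1 ∧ S.C = 1 ∧ S.IsDistortionConstant 1 ∧ S.weightedMean 1 < 0 := by
  have hev : ∀ᶠ μ : ℝ in atTop, 1 < μ ∧ g.deriv zr < μ ∧ μ⁻¹ < g.deriv za ∧
      (1 * 1 ^ 2 / (1 * ((μ - 1) / μ)) * (1 + 2 * g.deriv zr / (μ - g.deriv zr))) *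
      (∫ s in {s : UnitAddCircle | 1 ≤ g.deriv s}, Real.log (g.deriv s)) +
      ∫ s in {s : UnitAddCircle | g.deriv s < 1}, Real.log (g.deriv s) < 0 := by
    filter_upwards [eventually_gt_atTop 1, eventually_gt_atTop (g.deriv zr),
      (tendsto_inv_atTop_zero (𝕜 := ℝ)).eventually_lt_const (g.deriv_pos za),
      eventually_weightedMean_neg hg] with μ h1 h2 h3 h4
    exact ⟨h1, h2, h3, h4⟩
  obtain ⟨a, ha⟩ := eventually_atTop.1 hev
  obtain ⟨n, hn⟩ := exists_nat_ge a
  refine ⟨max n 1, fun N hN r hr => ?_⟩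
  obtain ⟨μ, hNμ, hμ⟩ := exists_eigenvalue ((le_max_right n 1).trans hN)
  have hnN : (n : ℝ) ≤ N := by exact_mod_cast (le_max_left n 1).trans hN
  obtain ⟨h1, h2, h3, h4⟩ := ha μ (by linarith)
  refine ⟨linearSystem hμ h1 hg h3 h2 hr, rfl, rfl, rfl, rfl, rfl, rfl, rfl,
    CoupledSystem.isDistortionConstant_one _ (a := μ) fun _ => rfl, ?_⟩
  have hα : (linearSystem hμ h1 hg h3 h2 hr).αuMin = μ := ciInf_const
  unfold CoupledSystem.weightedMean
  rw [hα]
  exact h4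

end SkewCoupling

end

theorem proposition4p5 :
    (∀ (S : SkewCoupling.CoupledSystem) (K : ℝ), S.IsDistortionConstant K →
      S.weightedMean K < 0 → S.ContractingCenter) ∧
    (∀ (g : SkewCoupling.CircleDiffeo) (zr za : UnitAddCircle),
      SkewCoupling.IsNorthSouth g zr za →
      ∃ N₀ : ℕ, ∀ N : ℕ, N₀ ≤ N → ∀ r : SkewCoupling.CircleDiffeo, (∀ z, r.deriv z = 1) →
        ∃ S : SkewCoupling.CoupledSystem,
          S.A = SkewCoupling.linearBase N ∧ S.g = g ∧ S.zr = zr ∧ S.za = za ∧ S.r = r ∧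
          S.c = 1 ∧ S.C = 1 ∧ S.IsDistortionConstant 1 ∧ S.weightedMean 1 < 0 ∧
          S.ContractingCenter) := by
  refine ⟨fun S K hK hneg => SkewCoupling.CoupledSystem.contractingCenter_of_weightedMean_neg hK
    hneg, fun g zr za hg => ?_⟩
  obtain ⟨N₀, hN₀⟩ := SkewCoupling.exists_linearSystem hg
  refine ⟨N₀, fun N hN r hr => ?_⟩
  obtain ⟨S, hA, hg', hzr, hza, hr', hc, hC, hK, hneg⟩ := hN₀ N hN r hr
  exact ⟨S, hA, hg', hzr, hza, hr', hc, hC, hK, hneg,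
    SkewCoupling.CoupledSystem.contractingCenter_of_weightedMean_neg hK hneg⟩
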